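/- All graphs are finite and simple. In the symmetry breaking-preserving game on a graph $G$, players $\mathcal A$ (red) and $\mathcal B$ (blue) alternately color uncolored edges of $G$, $\mathcal A$ moving first; a round is a move of $\mathcal A$ followed by a move of $\mathcal B$, and at most $\lfloor |E(G)|/2\rfloor$ rounds are played. $\mathcal B$ does not lose $r\le\lfloor |E(G)|/2\rfloor$ rounds if after each of the rounds $1,\dots,r$ the subgraphs formed by the red and by the blue edges are isomorphic. Let $L_{\mathrm{sym}}(G)=\max_{S_2}\min_{S_1}l(S_1,S_2)$, where $S_1,S_2$ range over the strategies of $\mathcal A,\mathcal B$ (maps from the sequences of the opponent's moves to legal moves) and $l(S_1,S_2)$ is the number of rounds that $\mathcal B$ does not lose when $S_1$ plays against $S_2$. In the Ehrenfeucht–Fraïssé game on graphs $H_0,H_1$ with disjoint vertex sets, in each round the spoiler picks a vertex of $H_0$ or $H_1$ (repetitions are allowed) and then the duplicator picks a vertex; the duplicator has to pick a vertex of the other graph so that the correspondence between the vertices picked so far is a partial isomorphism between $H_0$ and $H_1$. Let $\mathrm{EF}(H_0,H_1)\in\mathbb N\cup\{\infty\}$ be the maximum number of rounds that the duplicator can survive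 irrespective of the spoiler's strategy. Let $\mathcal L(G)$ denote the line graph of $G$. **Proposition.** If $G_1$ contains no triangle $K_3$, then for every graph $G_0$ $$L_{\mathrm{sym}}(G_1)\ \ge\ \min\bigl\{\bigl\lfloor\tfrac12\,\mathrm{EF}(\mathcal L(G_0),\mathcal L(G_1))\bigr\rfloor,\ L_{\mathrm{sym}}(G_0)\bigr\}$$ (with $\lfloor\infty/2\rfloor=\infty$). Moreover, there is a deterministic polynomial-time oracle algorithm with the following property. For all graphs $G_0,G_1$ with $G_1$ triangle-free, every strategy $D$ of the duplicator in the Ehrenfeucht–Fraïssé game on $\mathcal L(G_0),\mathcal L(G_1)$ and every strategy $S_0$ of the second player in the symmetry breaking-preserving game on $G_0$, the algorithm, given $G_0$, $G_1$ and the moves of $\mathcal A$ made so far, and with oracle access to $D$ and $S_0$, computes the moves of a strategy $S=S(D,S_0)$ of $\mathcal B$ in the symmetry breaking-preserving game on $G_1$ such that, for all $l,m\in\mathbb N$: if $D$ does not lose $l$ rounds irrespective of the spoiler's strategy and $S_0$ does not lose $m$ rounds irrespective of the first player's strategy, then $S$ does not lose $\min\{\lfloor l/2\rfloor,m\}$ rounds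 irrespective of $\mathcal A$'s strategy. The running time is bounded by a fixed polynomial in the bit length of the input ($G_0$, $G_1$ and the sequence of moves). -/

import Mathlib

namespace SymGame

/-! ### Strategies and plays of two-person games with perfect information -/

/-- A strategy of the player who moves first: it maps the (possibly empty) sequence of moves
made so far by the opponent to a move. -/
abbrev Starter (M : Type*) := List M → M

/-- A strategy of the player who moves second: it maps the nonempty sequence of moves made so far
by the opponent to a move. The nonempty sequence `e₁, …, eᵢ` is given as the list `e₁, …, eᵢ₋₁` of
the earlier moves together with the current move `eᵢ`. -/
abbrev Responder (M : Type*) := List M → M → M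

/-- The replies `τ(e₁), τ(e₁,e₂), …, τ(e₁,…,eᵢ)` to the opponent's moves `l = e₁, …, eᵢ`. -/
def replies {M : Type*} (τ : Responder M) (l : List M) : List M :=
  (List.finRange l.length).map fun j : Fin l.length => τ (l.take j) (l.get j)

/-- The first `i` moves of the starter when `σ` plays against `τ`; the first `i` moves of the
responder are then `replies τ (starterMoves σ τ i)`. -/
def starterMoves {M : Type*} (σ : Starter M) (τ : Responder M) : ℕ → List M
  | 0 => []
  | i + 1 => starterMoves σ τ i ++ [σ (replies τ (starterMoves σ τ i))]

section SymmetryGame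

variable {V : Type*}

/-- The graph formed by a set of edges: its vertices are the endpoints of these edges. -/
def edgeInduced (F : Set (Sym2 V)) : SimpleGraph {v : V // ∃ e ∈ F, v ∈ e} :=
  (SimpleGraph.fromEdgeSet F).comap Subtype.val

/-- The subgraphs formed by two lists of edges of `G` are isomorphic. -/
def IsoEdges {G : SimpleGraph V} (A B : List G.edgeSet) : Prop :=
  Nonempty (edgeInduced {e : Sym2 V | ∃ x ∈ A, (x : Sym2 V) = e} ≃g
    edgeInduced {e : Sym2 V | ∃ x ∈ B, (x : Sym2 V) = e})

/-- Strategies of the first player in the symmetry breaking-preserving game on `G`: a sequence of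
pairwise distinct edges is mapped to an edge outside the sequence that differs from the edges
chosen at its proper initial segments. The length restriction says that an uncolored edge is left. -/
def FirstStrategy (G : SimpleGraph V) : Type _ :=
  {σ : Starter G.edgeSet // ∀ l : List G.edgeSet, l.Nodup → 2 * l.length < Nat.card G.edgeSet →
    σ l ∉ l ∧ ∀ j < l.length, σ l ≠ σ (l.take j)}

/-- Strategies of the second player, subject to the same rules. -/
def SecondStrategy (G : SimpleGraph V) : Type _ :=
  {τ : Responder G.edgeSet // ∀ (l : List G.edgeSet) (a : G.edgeSet), (l ++ [a]).Nodup →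
    2 * (l.length + 1) ≤ Nat.card G.edgeSet → τ l a ∉ l ++ [a] ∧ τ l a ∉ replies τ l}

/-- The largest `l ≤ |E(G)| / 2` such that, when `σ` plays against `τ`, the red and the blue
subgraphs are isomorphic after each of the first `l` rounds. -/
noncomputable def symRounds {G : SimpleGraph V} (σ : FirstStrategy G) (τ : SecondStrategy G) : ℕ :=
  sSup {l : ℕ | l ≤ Nat.card G.edgeSet / 2 ∧ ∀ i ≤ l,
    IsoEdges (starterMoves σ.1 τ.1 i) (replies τ.1 (starterMoves σ.1 τ.1 i))}

/-- The number of rounds that `τ` does not lose irrespective of the first player's strategy. -/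
noncomputable def symGuarantee {G : SimpleGraph V} (τ : SecondStrategy G) : ℕ :=
  ⨅ σ : FirstStrategy G, symRounds σ τ

/-- The length of the symmetry breaking-preserving game on `G`. -/
noncomputable def symLength (G : SimpleGraph V) : ℕ :=
  ⨆ τ : SecondStrategy G, symGuarantee τ

end SymmetryGame

section EhrenfeuchtFraisse

variable {W₀ W₁ : Type*}

/-- The vertices `u` and `v` picked in one round lie in different graphs, `x` being the one in the
first graph and `y` the one in the second graph. -/
def Picks (u v : W₀ ⊕ W₁) (x : W₀) (y : W₁) : Prop :=
  (u = Sum.inl x ∧ v = Sum.inr y) ∨ (u = Sum.inr y ∧ v = Sum.inl x)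

/-- In every round the two players picked vertices of different graphs, and the resulting
correspondence between the picked vertices is a partial isomorphism. -/
def EFPosition (H₀ : SimpleGraph W₀) (H₁ : SimpleGraph W₁) (us vs : List (W₀ ⊕ W₁)) : Prop :=
  (∀ p ∈ us.zip vs, ∃ x y, Picks p.1 p.2 x y) ∧
  ∀ p ∈ us.zip vs, ∀ q ∈ us.zip vs, ∀ x y x' y', Picks p.1 p.2 x y → Picks q.1 q.2 x' y' →
    ((x = x' ↔ y = y') ∧ (H₀.Adj x x' ↔ H₁.Adj y y'))

/-- The largest number of rounds (possibly infinite) for which the duplicator `τ` obeys the rules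
of the Ehrenfeucht–Fraïssé game on `H₀` and `H₁` against the spoiler `σ`. -/
noncomputable def efRounds (H₀ : SimpleGraph W₀) (H₁ : SimpleGraph W₁)
    (σ : Starter (W₀ ⊕ W₁)) (τ : Responder (W₀ ⊕ W₁)) : ℕ∞ :=
  ⨆ l ∈ {l : ℕ | ∀ i ≤ l,
    EFPosition H₀ H₁ (starterMoves σ τ i) (replies τ (starterMoves σ τ i))}, (l : ℕ∞)

/-- The number of rounds that the duplicator `τ` does not lose irrespective of the spoiler's
strategy. -/
noncomputable def efGuarantee (H₀ : SimpleGraph W₀) (H₁ : SimpleGraph W₁)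
    (τ : Responder (W₀ ⊕ W₁)) : ℕ∞ :=
  ⨅ σ : Starter (W₀ ⊕ W₁), efRounds H₀ H₁ σ τ

/-- The length of the Ehrenfeucht–Fraïssé game on `H₀` and `H₁`; it is `⊤` if the duplicator can
play forever. -/
noncomputable def efLength (H₀ : SimpleGraph W₀) (H₁ : SimpleGraph W₁) : ℕ∞ :=
  ⨆ τ : Responder (W₀ ⊕ W₁), efGuarantee H₀ H₁ τ

end EhrenfeuchtFraisse

/-! ### Oracle programs

A machine model with logarithmic cost: registers hold words of natural numbers, a program is a
fixed finite text, and every step costs one plus the bit length of everything in the registers that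
the step reads or writes. Such programs and multitape oracle Turing machines, in which the query
and the answer are written and read symbol by symbol, simulate each other with polynomial
overhead. -/

/-- The bit length of a word of natural numbers, with a separator after each number. -/
def bitLength (w : List ℕ) : ℕ := (w.map fun x => Nat.size x + 1).sum

/-- The contents of the registers. -/
abbrev Store := ℕ → List ℕ

/-- Two word oracles. -/
abbrev Oracles := Fin 2 → List ℕ → List ℕ

/-- Elementary instructions. -/
inductive Instr
  /-- Load a constant word. -/
  | load (r : ℕ) (w : List ℕ)
  /-- Copy register `src` to register `dst`. -/
  | copy (src dst : ℕ)
  /-- Append the contents of `src` at the end of `dst`. -/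
  | append (src dst : ℕ)
  /-- Delete the first number (if any) of `src` and write it at the end of `dst`. -/
  | shift (src dst : ℕ)
  /-- Add one to the first number (if any) of `r`. -/
  | succ (r : ℕ)
  /-- Double the first number (if any) of `r`. -/
  | double (r : ℕ)
  /-- Halve the first number (if any) of `r`, rounding down. -/
  | half (r : ℕ)
  /-- Ask oracle `k` the query in `src` and write the answer to `dst`. -/
  | ask (k : Fin 2) (src dst : ℕ)

/-- The store after an instruction. -/
def Instr.run (O : Oracles) (s : Store) : Instr → Store
  | load r w => Function.update s r w
  | copy src dst => Function.update s dst (s src)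
  | append src dst => Function.update s dst (s dst ++ s src)
  | shift src dst =>
      let s' := Function.update s src (s src).tail
      Function.update s' dst (s' dst ++ (s src).take 1)
  | succ r => Function.update s r ((s r).modifyHead (· + 1))
  | double r => Function.update s r ((s r).modifyHead (2 * ·))
  | half r => Function.update s r ((s r).modifyHead (· / 2))
  | ask k src dst => Function.update s dst (O k (s src))

/-- The registers that an instruction reads or writes. -/
def Instr.regs : Instr → List ℕ
  | load r _ => [r]
  | copy src dst => [src, dst]
  | append src dst => [src, dst]
  | shift src dst => [src, dst]
  | succ r => [r]
  | double r => [r]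
  | half r => [r]
  | ask _ src dst => [src, dst]

/-- The cost of an instruction: one plus the bit lengths of the registers involved, before and
after the instruction. -/
def Instr.cost (O : Oracles) (s : Store) (c : Instr) : ℕ :=
  1 + (c.regs.map fun r => bitLength (s r) + bitLength (c.run O s r)).sum

/-- Tests: a register is empty, or two registers are equal. -/
inductive Test
  | empty (r : ℕ)
  | eq (r r' : ℕ)

/-- The truth of a test in a store. -/
def Test.Holds (s : Store) : Test → Prop
  | empty r => s r = []
  | eq r r' => s r = s r'

/-- The cost of a test. -/
def Test.cost (s : Store) : Test → ℕ
  | empty r => 1 + bitLength (s r)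
  | eq r r' => 1 + bitLength (s r) + bitLength (s r')

/-- Programs. -/
inductive Prog
  | basic (c : Instr)
  | seq (P Q : Prog)
  | ite (b : Test) (P Q : Prog)
  /-- Repeat `P` until the test holds. -/
  | untilDo (b : Test) (P : Prog)

/-- `Exec O P s t s'`: with oracles `O`, the program `P` started in the store `s` halts in the
store `s'` after steps of total cost `t`. -/
inductive Exec (O : Oracles) : Prog → Store → ℕ → Store → Prop
  | basic (c : Instr) (s : Store) : Exec O (.basic c) s (c.cost O s) (c.run O s)
  | seq {P Q : Prog} {s s₁ s₂ : Store} {t₁ t₂ : ℕ} :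
      Exec O P s t₁ s₁ → Exec O Q s₁ t₂ s₂ → Exec O (.seq P Q) s (t₁ + t₂) s₂
  | iteTrue {b : Test} {P Q : Prog} {s s' : Store} {t : ℕ} :
      b.Holds s → Exec O P s t s' → Exec O (.ite b P Q) s (b.cost s + t) s'
  | iteFalse {b : Test} {P Q : Prog} {s s' : Store} {t : ℕ} :
      ¬ b.Holds s → Exec O Q s t s' → Exec O (.ite b P Q) s (b.cost s + t) s'
  | untilStop {b : Test} {P : Prog} {s : Store} :
      b.Holds s → Exec O (.untilDo b P) s (b.cost s) s
  | untilStep {b : Test} {P : Prog} {s s₁ s₂ : Store} {t₁ t₂ : ℕ} :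
      ¬ b.Holds s → Exec O P s t₁ s₁ → Exec O (.untilDo b P) s₁ t₂ s₂ →
      Exec O (.untilDo b P) s (b.cost s + t₁ + t₂) s₂

/-- The initial store: the words `u`, `v`, `w` in registers 0, 1, 2, all other registers empty. -/
def initStore (u v w : List ℕ) : Store
  | 0 => u
  | 1 => v
  | 2 => w
  | _ => []

/-- On input `u, v, w` with oracles `O`, the program `P` halts at cost at most `T` with the word
`out` in register 0. -/
def Outputs (P : Prog) (O : Oracles) (u v w out : List ℕ) (T : ℕ) : Prop :=
  ∃ t s, Exec O P (initStore u v w) t s ∧ t ≤ T ∧ s 0 = out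

/-! ### Encodings of finite graphs on `{0, …, n - 1}` -/

/-- An edge is written as its smaller endpoint followed by its larger endpoint. -/
def encodeEdge {n : ℕ} {G : SimpleGraph (Fin n)} (e : G.edgeSet) : List ℕ :=
  [((e : Sym2 (Fin n)).inf : ℕ), ((e : Sym2 (Fin n)).sup : ℕ)]

/-- A sequence of edges. -/
def encodeEdges {n : ℕ} {G : SimpleGraph (Fin n)} (l : List G.edgeSet) : List ℕ :=
  l.flatMap encodeEdge

open Classical in
/-- A graph is written as its number of vertices followed by its edges in lexicographic order. -/
noncomputable def encodeGraph {n : ℕ} (G : SimpleGraph (Fin n)) : List ℕ :=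
  n :: (((List.finRange n ×ˢ List.finRange n).filter fun p => p.1 < p.2 ∧ G.Adj p.1 p.2).flatMap
    fun p => [(p.1 : ℕ), (p.2 : ℕ)])

/-- A move of the Ehrenfeucht–Fraïssé game on two line graphs is written as the number of the graph
followed by the edge. -/
def encodePick {n₀ n₁ : ℕ} {G₀ : SimpleGraph (Fin n₀)} {G₁ : SimpleGraph (Fin n₁)} :
    G₀.edgeSet ⊕ G₁.edgeSet → List ℕ
  | Sum.inl e => 0 :: encodeEdge e
  | Sum.inr e => 1 :: encodeEdge e

/-- Oracle 0 gives access to the duplicator's strategy `D` and oracle 1 to the strategy `S₀` in the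
symmetry breaking-preserving game on `G₀`. On words that do not encode a nonempty sequence of moves
the answers are arbitrary. -/
def OraclesFor {n₀ n₁ : ℕ} {G₀ : SimpleGraph (Fin n₀)} {G₁ : SimpleGraph (Fin n₁)}
    (D : Responder (G₀.edgeSet ⊕ G₁.edgeSet)) (S₀ : SecondStrategy G₀) (O : Oracles) : Prop :=
  (∀ l u, O 0 ((l ++ [u]).flatMap encodePick) = encodePick (D l u)) ∧
  ∀ l a, O 1 (encodeEdges (l ++ [a])) = encodeEdge (S₀.1 l a)

end SymGame

/-! The second player on `G₁` imitates a play on `G₀`. When the first player colors `e` in `G₁`, a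
simulated spoiler picks `e`; the duplicator's answer `f` is treated as a first player's move on
`G₀`; the strategy `S₀` replies with `g`; the spoiler picks `g`, and the duplicator's answer `h` is
the reply in `G₁`. One round on `G₁` thus uses two Ehrenfeucht–Fraïssé rounds and one round on `G₀`,
which gives the bound `min (l / 2) m`.

As long as the duplicator survives, the edges picked in `G₀` and `G₁` are matched injectively, so
`f` and `h` are uncolored whenever `e` and `g` are (`Sim.Sound.next`). The matching respects only
whether two edges share an endpoint, which in general does not determine a graph: a triangle and a
star with three edges have the same line graph. Therefore red and blue in `G₁` are compared with
each other, not with their counterparts in `G₀`: red edges of `G₁` go to red edges of `G₀` by the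
matching, then to blue edges of `G₀` by the isomorphism that `S₀` maintains, then to blue edges of
`G₁` by the matching. The composite is an incidence preserving bijection between two edge sets of
the triangle-free graph `G₁`. For triangle-free graphs the Whitney phenomenon has no exceptions, and
the bijection comes from a graph isomorphism (`IncidencePreserving.nonempty_iso`,
`IsoEdges.transfer`). No such assumption on `G₀` is needed, because the map there already comes from
an isomorphism.

Lengths of games are suprema and infima over strategies; they are converted into statements about
fixed move sequences by letting the opponent play a prescribed script
(`efPosition_of_le_efGuarantee`, `isoEdges_of_le_symGuarantee`). All this is collected in
`le_symGuarantee_simSecond`.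

The simulation is explicit, with the first uncolored edge as a fallback if the duplicator breaks the
rules. The program `simProg` replays it on the whole move sequence with two queries to `D` and one
to `S₀` per move (fewer after a broken rule). All registers stay quadratically bounded in the input
length, and `outputs_simProg` yields a running time of degree five. -/

namespace SymGame

/-! ### Incidence preserving maps between edge sets of triangle-free graphs -/

section Whitney

variable {V W : Type*}

/-- Two edges share an endpoint. -/
def Meets (e f : Sym2 V) : Prop := ∃ v, v ∈ e ∧ v ∈ f

/-- A map that is injective on the edges in `A` and under which two edges in `A` share an endpoint if
and only if their images do. -/
structure IncidencePreserving (A : Set (Sym2 V)) (φ : Sym2 V → Sym2 W) : Prop where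
  injOn : Set.InjOn φ A
  meets : ∀ e ∈ A, ∀ f ∈ A, Meets (φ e) (φ f) ↔ Meets e f

theorem Meets.eq_of_mem {e f : Sym2 V} (h : e ≠ f) {x y : V} (hx : x ∈ e) (hx' : x ∈ f)
    (hy : y ∈ e) (hy' : y ∈ f) : x = y := by
  by_contra hxy
  exact h (((Sym2.mem_and_mem_iff hxy).1 ⟨hx, hy⟩).trans ((Sym2.mem_and_mem_iff hxy).1 ⟨hx', hy'⟩).symm)

/-- In a triangle-free graph, two further edges at the two endpoints of an edge do not meet. -/
theorem not_meets_of_cliqueFree {G : SimpleGraph V} (hG : G.CliqueFree 3) {x y : V}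
    {e f : Sym2 V} (hxy : G.Adj x y) (he : e ∈ G.edgeSet) (hf : f ∈ G.edgeSet)
    (hne : e ≠ s(x, y)) (hnf : f ≠ s(x, y)) (hx : x ∈ e) (hy : y ∈ f) : ¬ Meets e f := by
  classical
  rintro ⟨z, hze, hzf⟩
  obtain ⟨a, rfl⟩ := hx
  obtain ⟨b, rfl⟩ := hy
  simp only [Sym2.mem_iff, SimpleGraph.mem_edgeSet] at *
  have h1 : a ≠ y := fun h => hne (by rw [h])
  have h2 : b ≠ x := fun h => hnf (by rw [h, Sym2.eq_swap])
  have hxy' := hxy.ne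
  have hab : a = b := by grind
  subst hab
  exact hG {x, y, a} (SimpleGraph.is3Clique_triple_iff.2 ⟨hxy, he, hf⟩)

variable {G : SimpleGraph V} {H : SimpleGraph W} {A : Set (Sym2 V)} {φ : Sym2 V → Sym2 W}

/-- Each edge `e` is mapped to `φ e` by a map of the endpoints that is compatible with all
edges at these endpoints. -/
theorem IncidencePreserving.exists_local (hφ : IncidencePreserving A φ) (hG : G.CliqueFree 3)
    (hH : H.CliqueFree 3) (hA : A ⊆ G.edgeSet) (hB : ∀ e ∈ A, φ e ∈ H.edgeSet) {e : Sym2 V}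
    (he : e ∈ A) :
    ∃ g : V → W, Sym2.map g e = φ e ∧ ∀ v ∈ e, ∀ f ∈ A, v ∈ f → g v ∈ φ f := by
  classical
  -- A second edge `f` at `u` whose image contains `x` fixes the orientation: `u` goes to `x` and
  -- `v` to `y`.
  have main : ∀ (u v : V) (x y : W), s(u, v) ∈ A → φ s(u, v) = s(x, y) →
      (∃ f ∈ A, f ≠ s(u, v) ∧ u ∈ f ∧ x ∈ φ f) →
      ∃ g : V → W, Sym2.map g s(u, v) = φ s(u, v) ∧
        ∀ w ∈ s(u, v), ∀ f ∈ A, w ∈ f → g w ∈ φ f := by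
    rintro u v x y huv hxy ⟨f, hf, hfe, huf, hxf⟩
    have hadj : G.Adj u v := hA huv
    have hadj' : H.Adj x y := by have := hB _ huv; rwa [hxy] at this
    have nfe : ∀ f ∈ A, f ≠ s(u, v) → φ f ≠ s(x, y) := fun f hf hne h =>
      hne (hφ.injOn hf huv (h.trans hxy.symm))
    have type : ∀ f ∈ A, (u ∈ f ∨ v ∈ f) → x ∈ φ f ∨ y ∈ φ f := by
      intro f hf hm
      have : Meets (φ f) (φ s(u, v)) := (hφ.meets _ hf _ huv).2 (by
        rcases hm with hm | hm
        · exact ⟨u, hm, by simp⟩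
        · exact ⟨v, hm, by simp⟩)
      obtain ⟨z, hz, hz'⟩ := this
      rw [hxy, Sym2.mem_iff] at hz'
      rcases hz' with rfl | rfl <;> simp [hz]
    have hu : ∀ f' ∈ A, u ∈ f' → x ∈ φ f' := by
      intro f' hf' huf'
      by_cases hne : f' = s(u, v)
      · rw [hne, hxy]; simp
      rcases type f' hf' (Or.inl huf') with h | h
      · exact h
      -- Here `f` and `f'` meet at `u`, while their images sit at the two ends of `s(x, y)` and
      -- would close a triangle in `H`. For edges at `v` the same argument runs backwards, with a
      -- triangle in `G`.
      · exact absurd ((hφ.meets _ hf _ hf').2 ⟨u, huf, huf'⟩)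
          (not_meets_of_cliqueFree hH hadj' (hB _ hf) (hB _ hf') (nfe _ hf hfe) (nfe _ hf' hne)
            hxf h)
    have hv : ∀ f' ∈ A, v ∈ f' → y ∈ φ f' := by
      intro f' hf' hvf'
      by_cases hne : f' = s(u, v)
      · rw [hne, hxy]; simp
      rcases type f' hf' (Or.inr hvf') with h | h
      · exact absurd ((hφ.meets _ hf _ hf').1 ⟨x, hxf, h⟩)
          (not_meets_of_cliqueFree hG hadj (hA hf) (hA hf') hfe hne huf hvf')
      · exact h
    refine ⟨fun w => if w = u then x else y, ?_, ?_⟩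
    · simp [hxy, hadj.ne']
    · intro w hw f' hf' hwf'
      rw [Sym2.mem_iff] at hw
      rcases hw with rfl | rfl
      · simpa using hu f' hf' hwf'
      · simpa [hadj.ne'] using hv f' hf' hwf'
  induction e using Sym2.ind with | _ u v => ?_
  obtain ⟨⟨x, y⟩, hxy⟩ := Quot.exists_rep (φ s(u, v))
  have hxy : φ s(u, v) = s(x, y) := hxy.symm
  have hadj : G.Adj u v := hA he
  by_cases hex : ∃ f ∈ A, f ≠ s(u, v) ∧ (u ∈ f ∨ v ∈ f)
  · obtain ⟨f, hf, hfe, hm⟩ := hex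
    have : Meets (φ f) (φ s(u, v)) := (hφ.meets _ hf _ he).2 (by
      rcases hm with hm | hm
      · exact ⟨u, hm, by simp⟩
      · exact ⟨v, hm, by simp⟩)
    obtain ⟨z, hz, hz'⟩ := this
    rw [hxy, Sym2.mem_iff] at hz'
    rcases hm with hm | hm <;> rcases hz' with rfl | rfl
    · exact main u v z y he hxy ⟨f, hf, hfe, hm, hz⟩
    · exact main u v z x he (hxy.trans Sym2.eq_swap) ⟨f, hf, hfe, hm, hz⟩
    · have := main v u z y (Sym2.eq_swap ▸ he) (Sym2.eq_swap ▸ hxy)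
        ⟨f, hf, by rwa [Sym2.eq_swap], hm, hz⟩
      rwa [Sym2.eq_swap] at this
    · have := main v u z x (Sym2.eq_swap ▸ he) (by rw [Sym2.eq_swap, hxy, Sym2.eq_swap])
        ⟨f, hf, by rwa [Sym2.eq_swap], hm, hz⟩
      rwa [Sym2.eq_swap] at this
  -- An edge isolated in `A` may be mapped in either orientation.
  · push Not at hex
    refine ⟨fun w => if w = u then x else y, by simp [hxy, hadj.ne'], ?_⟩
    intro w hw f hf hwf
    have : f = s(u, v) := by
      by_contra hne
      have := hex f hf hne
      rw [Sym2.mem_iff] at hw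
      rcases hw with rfl | rfl <;> simp_all
    subst this
    rw [hxy]
    dsimp only
    split_ifs <;> simp

/-- The line graph of a triangle-free graph determines the graph: an incidence preserving map
between edge sets of triangle-free graphs is induced by a map of the vertices. -/
theorem IncidencePreserving.exists_map (hφ : IncidencePreserving A φ) (hG : G.CliqueFree 3)
    (hH : H.CliqueFree 3) (hA : A ⊆ G.edgeSet) (hB : ∀ e ∈ A, φ e ∈ H.edgeSet) :
    ∃ g : {v : V // ∃ e ∈ A, v ∈ e} → W, ∀ u v (h : s(u, v) ∈ A),
      φ s(u, v) = s(g ⟨u, _, h, Sym2.mem_mk_left u v⟩, g ⟨v, _, h, Sym2.mem_mk_right u v⟩) := by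
  choose g hg hg' using fun e : A => hφ.exists_local hG hH hA hB e.2
  choose ed hed hmem using fun v : {v : V // ∃ e ∈ A, v ∈ e} => v.2
  -- The local maps agree at a common vertex: both values lie in the images of both edges, and these
  -- images are distinct, so they share at most one vertex.
  have key : ∀ (v : {v : V // ∃ e ∈ A, v ∈ e}) (e) (he : e ∈ A), v.1 ∈ e →
      g ⟨e, he⟩ v = g ⟨ed v, hed v⟩ v := by
    intro v e he hv
    by_cases h : ed v = e
    · subst h; rfl
    · refine Meets.eq_of_mem (fun h' => h (hφ.injOn (hed v) he h'.symm))
        (hg' ⟨e, he⟩ v hv e he hv) (hg' ⟨e, he⟩ v hv _ (hed v) (hmem v))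
        (hg' ⟨_, hed v⟩ v (hmem v) e he hv) (hg' ⟨_, hed v⟩ v (hmem v) _ (hed v) (hmem v))
  refine ⟨fun v => g ⟨ed v, hed v⟩ v, fun u v h => ?_⟩
  dsimp only
  rw [← key ⟨u, _⟩ s(u, v) h (by simp), ← key ⟨v, _⟩ s(u, v) h (by simp), ← hg ⟨_, h⟩]
  rfl

/-- An incidence preserving map from `A` onto `B` yields an isomorphism of the graphs formed by `A`
and `B`. -/
theorem IncidencePreserving.nonempty_iso (hφ : IncidencePreserving A φ) (hG : G.CliqueFree 3)
    (hH : H.CliqueFree 3) (hA : A ⊆ G.edgeSet) {B : Set (Sym2 W)} (hB : B ⊆ H.edgeSet)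
    (himg : φ '' A = B) : Nonempty (edgeInduced A ≃g edgeInduced B) := by
  have hAB : ∀ e ∈ A, φ e ∈ B := fun e he => himg ▸ Set.mem_image_of_mem _ he
  obtain ⟨g, hg⟩ := hφ.exists_map hG hH hA (fun e he => hB (hAB e he))
  have hgm : ∀ (v) (e) (he : e ∈ A) (hv : v ∈ e), g ⟨v, e, he, hv⟩ ∈ φ e := by
    rintro v e he ⟨w, rfl⟩
    rw [hg v w he]; simp
  have hne : ∀ u v (h : s(u, v) ∈ A), g ⟨u, _, h, Sym2.mem_mk_left u v⟩ ≠
      g ⟨v, _, h, Sym2.mem_mk_right u v⟩ := by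
    intro u v h heq
    have := hB (hAB _ h)
    rw [hg u v h, heq] at this
    exact this.ne rfl
  -- If `g` identified `u` and `v`, the images of `s(u, a)` and `s(v, b)` would meet, so the edges
  -- meet. They cannot meet in `u` or `v`, as an image would be a loop; so `a = b`, and the two
  -- edges have the same image.
  have hinj : Function.Injective g := by
    rintro ⟨u, e, he, a, rfl⟩ ⟨v, f, hf, b, rfl⟩ huv
    by_contra huv'
    have huv' : u ≠ v := fun h => huv' (Subtype.ext h)
    obtain ⟨z, hz, hz'⟩ := (hφ.meets _ he _ hf).1
      ⟨_, hgm u _ he (by simp), huv ▸ hgm v _ hf (by simp)⟩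
    have hav : a ≠ v := by
      rintro rfl
      exact hne u a he huv
    have hbu : b ≠ u := by
      rintro rfl
      exact hne v b hf huv.symm
    have hab : a = b := by
      simp only [Sym2.mem_iff] at hz hz'
      grind
    subst hab
    have h1 := hg u a he
    rw [huv, ← hg v a hf] at h1
    have := hφ.injOn he hf h1
    simp_all
  have hgB : ∀ v, ∃ e ∈ B, g v ∈ e := by
    rintro ⟨v, e, he, hv⟩
    exact ⟨φ e, hAB e he, hgm v e he hv⟩
  have hbij : Function.Bijective
      (fun v => (⟨g v, hgB v⟩ : {v : W // ∃ e ∈ B, v ∈ e})) := by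
    constructor
    · intro u v h
      exact hinj (Subtype.ext_iff.1 h)
    · rintro ⟨w, f, hf, hw⟩
      rw [← himg] at hf
      obtain ⟨e, he, rfl⟩ := hf
      induction e using Sym2.ind with | _ u v => ?_
      rw [hg u v he, Sym2.mem_iff] at hw
      rcases hw with rfl | rfl
      · exact ⟨⟨u, _⟩, rfl⟩
      · exact ⟨⟨v, _⟩, rfl⟩
  refine ⟨⟨Equiv.ofBijective _ hbij, ?_⟩⟩
  rintro u v
  simp only [edgeInduced, SimpleGraph.comap_adj, SimpleGraph.fromEdgeSet_adj,
    Equiv.ofBijective_apply]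
  constructor
  · rintro ⟨h, hn⟩
    rw [← himg] at h
    obtain ⟨e, he, hφe⟩ := h
    induction e using Sym2.ind with | _ a b => ?_
    rw [hg a b he, Sym2.eq_iff] at hφe
    have : s(a, b) = s(u.1, v.1) := by
      rcases hφe with ⟨h1, h2⟩ | ⟨h1, h2⟩
      · rw [← hinj h1, ← hinj h2]
      · exact Sym2.eq_iff.2 (Or.inr ⟨congrArg Subtype.val (hinj h1), congrArg Subtype.val (hinj h2)⟩)
    exact ⟨this ▸ he, fun h => hn (congrArg g (Subtype.ext h))⟩
  · rintro ⟨h, -⟩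
    exact ⟨hg u v h ▸ hAB _ h, hne u v h⟩

/-- An isomorphism of the graphs formed by `A` and `B` induces an incidence preserving map from `A`
onto `B`. -/
theorem exists_incidencePreserving {B : Set (Sym2 V)} (hA : A ⊆ G.edgeSet) (hB : B ⊆ G.edgeSet)
    (ψ : edgeInduced A ≃g edgeInduced B) :
    ∃ θ : Sym2 V → Sym2 V, IncidencePreserving A θ ∧ θ '' A = B := by
  classical
  -- The value off the endpoints of `A` is irrelevant; it only makes `Sym2.map p` total.
  let p : V → V := fun v => if h : ∃ e ∈ A, v ∈ e then (ψ ⟨v, h⟩).1 else v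
  have hp : ∀ v : {v : V // ∃ e ∈ A, v ∈ e}, p v = (ψ v).1 := fun v => dif_pos v.2
  have hpi : ∀ u v : {v : V // ∃ e ∈ A, v ∈ e}, p u = p v → u.1 = v.1 := by
    intro u v h
    rw [hp, hp] at h
    exact congrArg Subtype.val (ψ.injective (Subtype.ext h))
  refine ⟨Sym2.map p, ⟨?_, ?_⟩, ?_⟩
  · intro e he f hf hef
    induction e using Sym2.ind with | _ a b => ?_
    induction f using Sym2.ind with | _ c d => ?_
    have ha : ∃ e ∈ A, a ∈ e := ⟨_, he, by simp⟩
    have hb : ∃ e ∈ A, b ∈ e := ⟨_, he, by simp⟩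
    have hc : ∃ e ∈ A, c ∈ e := ⟨_, hf, by simp⟩
    have hd : ∃ e ∈ A, d ∈ e := ⟨_, hf, by simp⟩
    simp only [Sym2.map_mk, Sym2.eq_iff] at hef ⊢
    rcases hef with ⟨h1, h2⟩ | ⟨h1, h2⟩
    · exact Or.inl ⟨hpi ⟨_, ha⟩ ⟨_, hc⟩ h1, hpi ⟨_, hb⟩ ⟨_, hd⟩ h2⟩
    · exact Or.inr ⟨hpi ⟨_, ha⟩ ⟨_, hd⟩ h1, hpi ⟨_, hb⟩ ⟨_, hc⟩ h2⟩
  · intro e he f hf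
    constructor
    · rintro ⟨z, hz, hz'⟩
      obtain ⟨u, hu, rfl⟩ := Sym2.mem_map.1 hz
      obtain ⟨v, hv, huv⟩ := Sym2.mem_map.1 hz'
      have : v = u := hpi ⟨v, _, hf, hv⟩ ⟨u, _, he, hu⟩ huv
      exact ⟨u, hu, this ▸ hv⟩
    · rintro ⟨v, hv, hv'⟩
      exact ⟨p v, Sym2.mem_map.2 ⟨v, hv, rfl⟩, Sym2.mem_map.2 ⟨v, hv', rfl⟩⟩
  · ext f
    constructor
    · rintro ⟨e, he, rfl⟩
      induction e using Sym2.ind with | _ a b => ?_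
      have ha : ∃ e ∈ A, a ∈ e := ⟨_, he, by simp⟩
      have hb : ∃ e ∈ A, b ∈ e := ⟨_, he, by simp⟩
      have : (edgeInduced A).Adj ⟨a, ha⟩ ⟨b, hb⟩ := ⟨he, (hA he).ne⟩
      have := (ψ.map_adj_iff.2 this).1
      rw [Sym2.map_mk, hp ⟨a, ha⟩, hp ⟨b, hb⟩]
      exact this
    · intro hf
      induction f using Sym2.ind with | _ a b => ?_
      have ha : ∃ e ∈ B, a ∈ e := ⟨_, hf, by simp⟩
      have hb : ∃ e ∈ B, b ∈ e := ⟨_, hf, by simp⟩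
      have : (edgeInduced B).Adj ⟨a, ha⟩ ⟨b, hb⟩ := ⟨hf, (hB hf).ne⟩
      have := (ψ.symm.map_adj_iff.2 this).1
      refine ⟨_, this, ?_⟩
      rw [Sym2.map_mk]
      show s(p (ψ.symm ⟨a, ha⟩).1, p (ψ.symm ⟨b, hb⟩).1) = _
      rw [hp, hp]
      simp

end Whitney

/-! ### Carrying an isomorphism through a partial isomorphism of line graphs -/

section Transfer

variable {V W : Type*} {G : SimpleGraph V} {H : SimpleGraph W}

/-- `Meets` is the reflexive closure of adjacency in the line graph, so a partial isomorphism, which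
respects equality and adjacency, respects `Meets`. -/
theorem lineGraph_adj_or_eq_iff_meets (e f : G.edgeSet) :
    (e = f ∨ G.lineGraph.Adj e f) ↔ Meets (e : Sym2 V) (f : Sym2 V) := by
  rw [SimpleGraph.lineGraph_adj_iff_exists]
  constructor
  · rintro (rfl | ⟨-, v, h⟩)
    · obtain ⟨⟨⟨u, v⟩⟩, h⟩ := e
      exact ⟨u, Sym2.mem_mk_left u v, Sym2.mem_mk_left u v⟩
    · exact ⟨v, h⟩
  · rintro ⟨v, h⟩
    by_cases hef : e = f
    · exact Or.inl hef
    · exact Or.inr ⟨hef, v, h⟩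

/-- If a partial isomorphism `R` of line graphs matches `fs` with `es` and `gs` with `hs`, where
`es` and `hs` lie in a triangle-free graph, then an isomorphism of the graphs formed by `fs` and
`gs` carries over to `es` and `hs`. -/
theorem IsoEdges.transfer (hH : H.CliqueFree 3) {R : G.edgeSet → H.edgeSet → Prop}
    (hR : ∀ x y x' y', R x y → R x' y' →
      ((x = x' ↔ y = y') ∧ (G.lineGraph.Adj x x' ↔ H.lineGraph.Adj y y')))
    {fs gs : List G.edgeSet} {es hs : List H.edgeSet}
    (hfe : ∀ f ∈ fs, ∃ e ∈ es, R f e) (hef : ∀ e ∈ es, ∃ f ∈ fs, R f e)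
    (hgh : ∀ g ∈ gs, ∃ h ∈ hs, R g h) (hhg : ∀ h ∈ hs, ∃ g ∈ gs, R g h)
    (hiso : IsoEdges fs gs) : IsoEdges es hs := by
  obtain ⟨ψ⟩ := hiso
  obtain ⟨θ, hθ, himg⟩ := exists_incidencePreserving (G := G)
    (by rintro _ ⟨x, -, rfl⟩; exact x.2) (by rintro _ ⟨x, -, rfl⟩; exact x.2) ψ
  have hRm : ∀ x y x' y', R x y → R x' y' →
      (Meets (x : Sym2 V) (x' : Sym2 V) ↔ Meets (y : Sym2 W) (y' : Sym2 W)) := by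
    intro x y x' y' h h'
    rw [← lineGraph_adj_or_eq_iff_meets, ← lineGraph_adj_or_eq_iff_meets, (hR _ _ _ _ h h').1,
      (hR _ _ _ _ h h').2]
  -- The composite of the matching, `θ` and the matching, stated for all of `Sym2 W` so that a total
  -- function can be chosen; outside `es` the value is arbitrary.
  have hex : ∀ e : Sym2 W, ∃ k : Sym2 W, ∀ e' ∈ es, (e' : Sym2 W) = e →
      ∃ f ∈ fs, ∃ g ∈ gs, ∃ h ∈ hs, R f e' ∧ θ f = g ∧ R g h ∧ (h : Sym2 W) = k := by
    intro e
    by_cases he : ∃ e' ∈ es, (e' : Sym2 W) = e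
    · obtain ⟨e', he', rfl⟩ := he
      obtain ⟨f, hf, hfe'⟩ := hef e' he'
      obtain ⟨g, hg, hgf⟩ : θ f ∈ {e : Sym2 V | ∃ x ∈ gs, (x : Sym2 V) = e} :=
        himg ▸ Set.mem_image_of_mem θ ⟨f, hf, rfl⟩
      obtain ⟨h, hh, hgh'⟩ := hgh g hg
      refine ⟨h, fun e'' _ h'' => ?_⟩
      rw [Subtype.ext h'']
      exact ⟨f, hf, g, hg, h, hh, hfe', hgf.symm, hgh', rfl⟩
    · exact ⟨e, fun e' h h' => (he ⟨e', h, h'⟩).elim⟩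
  choose φ hφ using hex
  have hinc : IncidencePreserving {e : Sym2 W | ∃ x ∈ es, (x : Sym2 W) = e} φ := by
    constructor
    · rintro _ ⟨e, he, rfl⟩ _ ⟨e', he', rfl⟩ heq
      obtain ⟨f, hf, g, hg, h, hh, h1, h2, h3, h4⟩ := hφ _ e he rfl
      obtain ⟨f', hf', g', hg', h', hh', h1', h2', h3', h4'⟩ := hφ _ e' he' rfl
      have : h = h' := Subtype.ext (by rw [h4, h4', heq])
      have : g = g' := (hR _ _ _ _ h3 h3').1.2 this
      have : (f : Sym2 V) = f' := hθ.injOn ⟨f, hf, rfl⟩ ⟨f', hf', rfl⟩ (by rw [h2, h2', this])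
      exact congrArg Subtype.val ((hR _ _ _ _ h1 h1').1.1 (Subtype.ext this))
    · rintro _ ⟨e, he, rfl⟩ _ ⟨e', he', rfl⟩
      obtain ⟨f, hf, g, hg, h, hh, h1, h2, h3, h4⟩ := hφ _ e he rfl
      obtain ⟨f', hf', g', hg', h', hh', h1', h2', h3', h4'⟩ := hφ _ e' he' rfl
      rw [← h4, ← h4', ← hRm _ _ _ _ h3 h3', ← h2, ← h2',
        hθ.meets _ ⟨f, hf, rfl⟩ _ ⟨f', hf', rfl⟩, hRm _ _ _ _ h1 h1']
  refine hinc.nonempty_iso hH hH (by rintro _ ⟨x, -, rfl⟩; exact x.2)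
    (by rintro _ ⟨x, -, rfl⟩; exact x.2) ?_
  ext k
  constructor
  · rintro ⟨_, ⟨e, he, rfl⟩, rfl⟩
    obtain ⟨f, hf, g, hg, h, hh, h1, h2, h3, h4⟩ := hφ _ e he rfl
    exact ⟨h, hh, h4⟩
  · rintro ⟨h, hh, rfl⟩
    obtain ⟨g, hg, hgh'⟩ := hhg h hh
    obtain ⟨_, ⟨f, hf, rfl⟩, hfg⟩ : (g : Sym2 V) ∈ θ '' {e : Sym2 V | ∃ x ∈ fs, (x : Sym2 V) = e} :=
      himg ▸ ⟨g, hg, rfl⟩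
    obtain ⟨e, he, hfe'⟩ := hfe f hf
    refine ⟨e, ⟨e, he, rfl⟩, ?_⟩
    obtain ⟨f', hf', g', hg', h', hh', h1, h2, h3, h4⟩ := hφ _ e he rfl
    have : f' = f := (hR _ _ _ _ h1 hfe').1.2 rfl
    subst this
    have : g' = g := Subtype.ext (h2.symm.trans hfg)
    subst this
    rw [← h4, (hR _ _ _ _ h3 hgh').1.1 rfl]

end Transfer

/-! ### Plays and their initial segments -/

section Plays

variable {M : Type*}

theorem length_replies (τ : Responder M) (l : List M) : (replies τ l).length = l.length := by
  simp [replies]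

theorem length_starterMoves (σ : Starter M) (τ : Responder M) (i : ℕ) :
    (starterMoves σ τ i).length = i := by
  induction i with
  | zero => rfl
  | succ i ih => simp [starterMoves, ih]

@[simp]
theorem replies_nil (τ : Responder M) : replies τ [] = [] := rfl

theorem replies_append_singleton (τ : Responder M) (l : List M) (a : M) :
    replies τ (l ++ [a]) = replies τ l ++ [τ l a] := by
  apply List.ext_getElem
  · simp [length_replies]
  · intro i h₁ h₂
    simp only [length_replies, List.length_append, List.length_singleton] at h₁
    rcases Nat.lt_or_ge i l.length with h | h
    · rw [List.getElem_append_left (by rwa [length_replies])]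
      simp [replies, List.getElem_append_left h, List.take_append_of_le_length h.le]
    · obtain rfl : i = l.length := by omega
      rw [List.getElem_append_right (by rw [length_replies])]
      simp [replies]

theorem replies_take (τ : Responder M) (l : List M) (i : ℕ) :
    replies τ (l.take i) = (replies τ l).take i := by
  induction l using List.reverseRecOn with
  | nil => simp
  | append_singleton l a ih =>
    rcases Nat.lt_or_ge l.length i with h | h
    · rw [List.take_of_length_le (by simp; omega), List.take_of_length_le
        (by simp [length_replies]; omega)]
    · rw [List.take_append_of_le_length h, replies_append_singleton,
        List.take_append_of_le_length (by rwa [length_replies]), ih]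

/-- A starter whose answers to the replies to the proper initial segments of `l` are the entries of
`l` plays the moves of `l`. -/
theorem starterMoves_eq_of_forall {σ : Starter M} {τ : Responder M} {l : List M}
    (h : ∀ (i : ℕ) (hi : i < l.length), σ ((replies τ l).take i) = l[i]) {i : ℕ}
    (hi : i ≤ l.length) : starterMoves σ τ i = l.take i := by
  induction i with
  | zero => simp [starterMoves]
  | succ i ih =>
    rw [starterMoves, ih (by omega), replies_take, h i hi, List.take_append_getElem]

end Plays

/-! ### Guarantees in the Ehrenfeucht–Fraïssé game -/

section EhrenfeuchtFraisse

variable {W₀ W₁ : Type*} {H₀ : SimpleGraph W₀} {H₁ : SimpleGraph W₁}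

/-- A duplicator who does not lose `l` rounds keeps a partial isomorphism along every sequence of at
most `l` moves of the spoiler. -/
theorem efPosition_of_le_efGuarantee {τ : Responder (W₀ ⊕ W₁)} {l : ℕ}
    (h : (l : ℕ∞) ≤ efGuarantee H₀ H₁ τ) {us : List (W₀ ⊕ W₁)} (hus : us.length ≤ l) :
    EFPosition H₀ H₁ us (replies τ us) := by
  rcases us with _ | ⟨u, us⟩
  · simp [EFPosition]
  generalize hL : u :: us = L at *
  -- A spoiler following the script `L`: it reads only the number of replies, and the default `u` is
  -- not reached within the script.
  let σ : Starter (W₀ ⊕ W₁) := fun r => L.getD r.length u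
  have hσ := h.trans (iInf_le _ σ)
  have hmoves : starterMoves σ τ L.length = L := by
    rw [starterMoves_eq_of_forall _ le_rfl, List.take_length]
    intro i hi
    simp [σ, length_replies, hi.le, hi]
  have hne : L.length ≠ 0 := by simp [← hL]
  -- A supremum need not be attained, so a strict inequality is needed to extract some `j` beyond
  -- `L.length - 1`.
  have hlt : ((L.length - 1 : ℕ) : ℕ∞) < efRounds H₀ H₁ σ τ :=
    lt_of_lt_of_le (by exact_mod_cast (by omega : L.length - 1 < l)) hσ
  rw [efRounds, lt_iSup_iff] at hlt
  obtain ⟨j, hj⟩ := hlt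
  rw [lt_iSup_iff] at hj
  obtain ⟨hj, hlt⟩ := hj
  have hlt : L.length - 1 < j := by exact_mod_cast hlt
  have := hj L.length (by omega)
  rwa [hmoves] at this

/-- The supremum may be infinite and unattained, but each finite value below it is reached by one
strategy. For `l = 0` nonemptiness is what provides a strategy at all. -/
theorem exists_le_efGuarantee {l : ℕ} (h : (l : ℕ∞) ≤ efLength H₀ H₁)
    (hne : Nonempty (W₀ ⊕ W₁)) : ∃ τ, (l : ℕ∞) ≤ efGuarantee H₀ H₁ τ := by
  rcases l with _ | l
  · exact ⟨fun _ _ => hne.some, by simp⟩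
  · have : (l : ℕ∞) < efLength H₀ H₁ := lt_of_lt_of_le (by exact_mod_cast l.lt_succ_self) h
    obtain ⟨τ, hτ⟩ := lt_iSup_iff.1 this
    exact ⟨τ, by simpa using Order.add_one_le_of_lt hτ⟩

end EhrenfeuchtFraisse

/-! ### Guarantees in the symmetry breaking-preserving game -/

section SymmetryGame

variable {V : Type*} {G : SimpleGraph V}

theorem exists_notMem_of_length_lt [Finite V] {l : List G.edgeSet}
    (h : l.length < Nat.card G.edgeSet) : ∃ x, x ∉ l := by
  classical
  have := Fintype.ofFinite G.edgeSet
  by_contra! hall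
  have h1 : (Finset.univ : Finset G.edgeSet) ⊆ l.toFinset := fun x _ => by simpa using hall x
  have h2 := (Finset.card_le_card h1).trans l.toFinset_card_le
  rw [Finset.card_univ, ← Nat.card_eq_fintype_card] at h2
  omega

open Classical in
/-- The first player who plays the moves `fs` as long as the replies are those in `gs` and an
arbitrary uncolored edge otherwise. -/
noncomputable def followOr (fs gs : List G.edgeSet) (d : G.edgeSet) (l : List G.edgeSet) :
    G.edgeSet :=
  if h : l.length < fs.length ∧ l = gs.take l.length then fs[l.length] else
  if h : ∃ x, x ∉ l ∧ ∀ j : Fin l.length, x ≠ followOr fs gs d (l.take j) then h.choose else d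
termination_by l.length
decreasing_by simp

/-- A strategy must be legal on all sequences of replies, so a script for one play has to be
completed off that play; `followOr` does this. On the script, initial segments are on the script
too, and legality reduces to distinctness of the listed edges. -/
theorem exists_firstStrategy [Finite V] [Nonempty G.edgeSet] {fs gs : List G.edgeSet}
    (hlen : fs.length = gs.length) (hnd : (fs ++ gs).Nodup) :
    ∃ σ : FirstStrategy G, ∀ (i : ℕ) (hi : i < fs.length), σ.1 (gs.take i) = fs[i] := by
  obtain ⟨d⟩ := ‹Nonempty G.edgeSet›
  have hfollow : ∀ (i : ℕ) (hi : i < fs.length), followOr fs gs d (gs.take i) = fs[i] := by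
    intro i hi
    have h1 : (gs.take i).length = i := by simp; omega
    rw [followOr, dif_pos ⟨by rwa [h1], by rw [h1]⟩]
    simp [h1]
  refine ⟨⟨followOr fs gs d, fun l hl hcard => ?_⟩, hfollow⟩
  by_cases h : l.length < fs.length ∧ l = gs.take l.length
  · obtain ⟨h1, h2⟩ := h
    rw [List.nodup_append] at hnd
    have h3 := hfollow _ h1
    rw [← h2] at h3
    have hsub : ∀ x ∈ l, x ∈ gs := fun x hx => by
      rw [h2] at hx
      exact List.mem_of_mem_take hx
    rw [h3]
    refine ⟨fun hm => hnd.2.2 _ (List.getElem_mem _) _ (hsub _ hm) rfl, fun j hj => ?_⟩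
    · have htake : l.take j = gs.take j := by
        conv_lhs => rw [h2, List.take_take, min_eq_left hj.le]
      rw [htake, hfollow j (by omega)]
      intro h4
      have := (List.Nodup.getElem_inj_iff hnd.1).1 h4
      omega
  · rw [followOr, dif_neg h]
    -- At most `2 * l.length` edges are excluded, fewer than there are, so the default `d` is not
    -- used here.
    have hex : ∃ x, x ∉ l ∧ ∀ j : Fin l.length, x ≠ followOr fs gs d (l.take j) := by
      obtain ⟨x, hx⟩ := exists_notMem_of_length_lt (G := G) (l := l ++
        (List.finRange l.length).map fun j : Fin l.length => followOr fs gs d (l.take j))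
        (by simp only [List.length_append, List.length_map, List.length_finRange]; omega)
      simp only [List.mem_append, List.mem_map, List.mem_finRange, true_and, not_or,
        not_exists] at hx
      exact ⟨x, hx.1, fun j h => hx.2 j h.symm⟩
    rw [dif_pos hex]
    exact ⟨hex.choose_spec.1, fun j hj => hex.choose_spec.2 ⟨j, hj⟩⟩

theorem isoEdges_nil : IsoEdges ([] : List G.edgeSet) [] := ⟨SimpleGraph.Iso.refl⟩

theorem bddAbove_symRounds (σ : FirstStrategy G) (τ : SecondStrategy G) :
    BddAbove {l : ℕ | l ≤ Nat.card G.edgeSet / 2 ∧ ∀ i ≤ l,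
      IsoEdges (starterMoves σ.1 τ.1 i) (replies τ.1 (starterMoves σ.1 τ.1 i))} :=
  ⟨_, fun _ h => h.1⟩

/-- The set behind `symRounds` is bounded, closed downwards and contains `0` (two empty graphs are
isomorphic), so its supremum is a maximum. -/
theorem le_symRounds_iff {σ : FirstStrategy G} {τ : SecondStrategy G} {m : ℕ} :
    m ≤ symRounds σ τ ↔ m ≤ Nat.card G.edgeSet / 2 ∧ ∀ i ≤ m,
      IsoEdges (starterMoves σ.1 τ.1 i) (replies τ.1 (starterMoves σ.1 τ.1 i)) := by
  constructor
  · intro h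
    have hmem := Nat.sSup_mem (s := {l : ℕ | l ≤ Nat.card G.edgeSet / 2 ∧ ∀ i ≤ l,
      IsoEdges (starterMoves σ.1 τ.1 i) (replies τ.1 (starterMoves σ.1 τ.1 i))})
      ⟨0, by simp, fun i hi => by
        obtain rfl : i = 0 := by omega
        exact isoEdges_nil⟩ (bddAbove_symRounds σ τ)
    exact ⟨h.trans hmem.1, fun i hi => hmem.2 i (hi.trans h)⟩
  · exact fun h => le_csSup (bddAbove_symRounds σ τ) h

/-- Without edges the first player has no strategy, and an infimum over the empty type is `0` in
`ℕ`. -/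
theorem nonempty_edgeSet_of_pos_symGuarantee {τ : SecondStrategy G} (h : 0 < symGuarantee τ) :
    Nonempty G.edgeSet := by
  by_contra hne
  have : IsEmpty (FirstStrategy G) := ⟨fun σ => hne ⟨σ.1 []⟩⟩
  simp [symGuarantee] at h

theorem symGuarantee_le (τ : SecondStrategy G) : symGuarantee τ ≤ Nat.card G.edgeSet / 2 := by
  rcases isEmpty_or_nonempty (FirstStrategy G) with h | ⟨⟨σ⟩⟩
  · simp [symGuarantee]
  · exact (ciInf_le (OrderBot.bddBelow _) σ).trans (le_symRounds_iff.1 le_rfl).1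

/-- A second player who does not lose `m` rounds keeps the two subgraphs isomorphic along every legal
sequence of at most `m` moves of the first player. -/
theorem isoEdges_of_le_symGuarantee [Finite V] {τ : SecondStrategy G} {m : ℕ}
    (h : m ≤ symGuarantee τ) {fs : List G.edgeSet} (hfs : fs.length ≤ m)
    (hnd : (fs ++ replies τ.1 fs).Nodup) : IsoEdges fs (replies τ.1 fs) := by
  rcases fs with _ | ⟨f, fs⟩
  · exact isoEdges_nil
  have : Nonempty G.edgeSet := ⟨f⟩
  generalize f :: fs = L at *
  obtain ⟨σ, hσ⟩ := exists_firstStrategy (length_replies τ.1 L).symm hnd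
  have := (le_symRounds_iff.1 (h.trans (ciInf_le (OrderBot.bddBelow _) σ))).2 L.length hfs
  rwa [starterMoves_eq_of_forall hσ le_rfl, List.take_length] at this

theorem nonempty_firstStrategy [Finite V] [Nonempty G.edgeSet] : Nonempty (FirstStrategy G) :=
  ⟨(exists_firstStrategy (G := G) (fs := []) (gs := []) rfl (by simp)).choose⟩

theorem bddAbove_symGuarantee : BddAbove (Set.range (symGuarantee (G := G))) :=
  ⟨_, by rintro _ ⟨τ, rfl⟩; exact symGuarantee_le τ⟩

theorem symGuarantee_le_symLength (τ : SecondStrategy G) : symGuarantee τ ≤ symLength G :=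
  le_ciSup bddAbove_symGuarantee τ

theorem exists_symGuarantee_eq_symLength (h : 0 < symLength G) :
    ∃ τ : SecondStrategy G, symGuarantee τ = symLength G := by
  have hne : Nonempty (SecondStrategy G) := by
    by_contra hne
    rw [not_nonempty_iff] at hne
    simp [symLength] at h
  exact Nat.sSup_mem (Set.range_nonempty _) bddAbove_symGuarantee

end SymmetryGame

/-! ### The simulated strategy -/

section Simulation

variable {E₀ E₁ : Type*}

open Classical in
/-- The first entry of the list outside `used`; the last entry (or `c` for the empty list) if there
is none. -/
noncomputable def pickFresh (used : List E₁) : E₁ → List E₁ → E₁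
  | c, [] => c
  | _, c :: l => if c ∈ used then pickFresh used c l else c

theorem pickFresh_notMem {used : List E₁} {c : E₁} {l : List E₁} (h : ∃ x ∈ l, x ∉ used) :
    pickFresh used c l ∉ used := by
  induction l generalizing c with
  | nil => simp at h
  | cons a l ih =>
    rw [pickFresh]
    split_ifs with ha
    · refine ih ?_
      obtain ⟨x, hx, hx'⟩ := h
      rcases List.mem_cons.1 hx with rfl | hx
      · exact (hx' ha).elim
      · exact ⟨x, hx, hx'⟩
    · exact ha

theorem pickFresh_cons_of_notMem {used : List E₁} {a c : E₁} {l : List E₁} (h : c ∉ used) :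
    pickFresh used a (c :: l) = c := by
  rw [pickFresh, if_neg h]

/-- The data kept while the moves of the first player on the second graph are processed. -/
structure Sim (E₀ E₁ : Type*) where
  /-- The edges of the second graph colored so far. -/
  used : List E₁
  /-- The moves of the simulated spoiler. -/
  picks : List (E₀ ⊕ E₁)
  /-- The moves of the simulated first player on the first graph. -/
  queries : List E₀

/-- The data before the first move. -/
def Sim.start : Sim E₀ E₁ := ⟨[], [], []⟩

variable (D : Responder (E₀ ⊕ E₁)) (τ : Responder E₀) (all : List E₁)

/-- The spoiler's moves after the first player's move `e`: the spoiler picks `e` and then the reply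
of `τ` to the duplicator's answer. -/
def Sim.nextPicks (s : Sim E₀ E₁) (e : E₁) : List (E₀ ⊕ E₁) :=
  match D s.picks (Sum.inr e) with
  | Sum.inl f => s.picks ++ [Sum.inr e] ++ [Sum.inl (τ s.queries f)]
  | Sum.inr _ => s.picks ++ [Sum.inr e]

/-- The simulated moves on the first graph after the first player's move `e`. -/
def Sim.nextQueries (s : Sim E₀ E₁) (e : E₁) : List E₀ :=
  match D s.picks (Sum.inr e) with
  | Sum.inl f => s.queries ++ [f]
  | Sum.inr _ => s.queries

/-- The answer to `e` suggested by the simulation, or `e` if the duplicator broke the rules. -/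
def Sim.candidate (s : Sim E₀ E₁) (e : E₁) : E₁ :=
  match D s.picks (Sum.inr e) with
  | Sum.inl f => Sum.elim (fun _ => e) id (D (s.picks ++ [Sum.inr e]) (Sum.inl (τ s.queries f)))
  -- The edge `e` is itself already colored, so `Sim.reply` skips it and turns to `all`.
  | Sum.inr _ => e

/-- The answer to `e`: the suggested edge if it is uncolored, otherwise the first uncolored edge
in the list `all`. -/
noncomputable def Sim.reply (s : Sim E₀ E₁) (e : E₁) : E₁ :=
  pickFresh (s.used ++ [e]) (s.candidate D τ e) (s.candidate D τ e :: all)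

/-- The data after the first player's move `e` and the reply to it. -/
noncomputable def Sim.next (s : Sim E₀ E₁) (e : E₁) : Sim E₀ E₁ :=
  ⟨s.used ++ [e] ++ [s.reply D τ all e], s.nextPicks D τ e, s.nextQueries D e⟩

/-- The data after the moves `l` of the first player. -/
noncomputable def Sim.after (l : List E₁) : Sim E₀ E₁ :=
  l.foldl (Sim.next D τ all) Sim.start

/-- The strategy obtained by the simulation. -/
noncomputable def simStrategy : Responder E₁ := fun l e => (Sim.after D τ all l).reply D τ all e

theorem Sim.after_append (l : List E₁) (e : E₁) :
    Sim.after D τ all (l ++ [e]) = (Sim.after D τ all l).next D τ all e := by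
  simp [Sim.after]

theorem Sim.mem_used_after {l : List E₁} {x : E₁} :
    x ∈ (Sim.after D τ all l).used ↔ x ∈ l ∨ x ∈ replies (simStrategy D τ all) l := by
  induction l using List.reverseRecOn with
  | nil => simp [Sim.after, Sim.start]
  | append_singleton l e ih =>
    rw [Sim.after_append, replies_append_singleton]
    simp only [Sim.next, List.mem_append, ih, List.mem_singleton, simStrategy]
    tauto

theorem Sim.length_used_after (l : List E₁) :
    (Sim.after D τ all l).used.length = 2 * l.length := by
  induction l using List.reverseRecOn with
  | nil => simp [Sim.after, Sim.start]
  | append_singleton l e ih =>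
    rw [Sim.after_append]
    simp only [Sim.next, List.length_append, ih, List.length_singleton]
    ring

/-- Only an inequality, because a round in which the duplicator breaks the rules may add a single
pick. It holds for every `D`, as the running time bound must. -/
theorem Sim.length_picks_after_le (l : List E₁) :
    (Sim.after D τ all l).picks.length ≤ 2 * l.length := by
  induction l using List.reverseRecOn with
  | nil => simp [Sim.after, Sim.start]
  | append_singleton l e ih =>
    rw [Sim.after_append]
    simp only [Sim.next, Sim.nextPicks]
    split <;> simp <;> omega

theorem Sim.length_queries_after_le (l : List E₁) :
    (Sim.after D τ all l).queries.length ≤ l.length := by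
  induction l using List.reverseRecOn with
  | nil => simp [Sim.after, Sim.start]
  | append_singleton l e ih =>
    rw [Sim.after_append]
    simp only [Sim.next, Sim.nextQueries]
    split <;> simp <;> omega

end Simulation

/-! ### The matching produced by the duplicator -/

section Matched

variable {W₀ W₁ : Type*} {H₀ : SimpleGraph W₀} {H₁ : SimpleGraph W₁}

/-- The vertices `x` and `y` were picked in the same round when the spoiler played `us`. -/
def Matched (D : Responder (W₀ ⊕ W₁)) (us : List (W₀ ⊕ W₁)) (x : W₀) (y : W₁) : Prop :=
  (Sum.inl x, Sum.inr y) ∈ us.zip (replies D us) ∨ (Sum.inr y, Sum.inl x) ∈ us.zip (replies D us)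

variable {D : Responder (W₀ ⊕ W₁)} {us : List (W₀ ⊕ W₁)} {x x' : W₀} {y y' : W₁}

theorem zip_replies_append (D : Responder (W₀ ⊕ W₁)) (us : List (W₀ ⊕ W₁)) (u : W₀ ⊕ W₁) :
    (us ++ [u]).zip (replies D (us ++ [u])) = us.zip (replies D us) ++ [(u, D us u)] := by
  rw [replies_append_singleton, List.zip_append (length_replies D us).symm]
  rfl

theorem Matched.append (h : Matched D us x y) (u : W₀ ⊕ W₁) : Matched D (us ++ [u]) x y := by
  rw [Matched, zip_replies_append]
  exact h.imp (List.mem_append_left _) (List.mem_append_left _)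

theorem matched_append_inl (h : D us (Sum.inl x) = Sum.inr y) :
    Matched D (us ++ [Sum.inl x]) x y := by
  rw [Matched, zip_replies_append, h]
  simp

theorem matched_append_inr (h : D us (Sum.inr y) = Sum.inl x) :
    Matched D (us ++ [Sum.inr y]) x y := by
  rw [Matched, zip_replies_append, h]
  simp

theorem Matched.picks (h : Matched D us x y) :
    ∃ p ∈ us.zip (replies D us), Picks p.1 p.2 x y :=
  h.elim (fun h => ⟨_, h, Or.inl ⟨rfl, rfl⟩⟩) fun h => ⟨_, h, Or.inr ⟨rfl, rfl⟩⟩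

theorem Matched.partialIso (hpos : EFPosition H₀ H₁ us (replies D us)) (h : Matched D us x y)
    (h' : Matched D us x' y') : (x = x' ↔ y = y') ∧ (H₀.Adj x x' ↔ H₁.Adj y y') := by
  obtain ⟨p, hp, hp'⟩ := h.picks
  obtain ⟨q, hq, hq'⟩ := h'.picks
  exact hpos.2 p hp q hq x y x' y' hp' hq'

theorem exists_inr_of_efPosition
    (hpos : EFPosition H₀ H₁ (us ++ [Sum.inl x]) (replies D (us ++ [Sum.inl x]))) :
    ∃ y, D us (Sum.inl x) = Sum.inr y := by
  obtain ⟨x', y', h | h⟩ := hpos.1 (Sum.inl x, D us (Sum.inl x)) (by simp [zip_replies_append])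
  · exact ⟨y', h.2⟩
  · simp at h

theorem exists_inl_of_efPosition
    (hpos : EFPosition H₀ H₁ (us ++ [Sum.inr y]) (replies D (us ++ [Sum.inr y]))) :
    ∃ x, D us (Sum.inr y) = Sum.inl x := by
  obtain ⟨x', y', h | h⟩ := hpos.1 (Sum.inr y, D us (Sum.inr y)) (by simp [zip_replies_append])
  · simp at h
  · exact ⟨x', h.2⟩

end Matched

/-! ### The simulation preserves guarantees -/

section Guarantee

variable {V₀ V₁ : Type*} {G₀ : SimpleGraph V₀} {G₁ : SimpleGraph V₁}

/-- Legality does not depend on the quality of `D` or `τ`: at most `2 * l.length + 1` edges are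
colored, so the fallback through `all` finds an uncolored one. -/
theorem simStrategy_legal [Finite V₁] (D : Responder (G₀.edgeSet ⊕ G₁.edgeSet))
    (τ : Responder G₀.edgeSet) {all : List G₁.edgeSet} (hall : ∀ e, e ∈ all)
    (l : List G₁.edgeSet) (a : G₁.edgeSet) (hcard : 2 * (l.length + 1) ≤ Nat.card G₁.edgeSet) :
    simStrategy D τ all l a ∉ l ++ [a] ∧
      simStrategy D τ all l a ∉ replies (simStrategy D τ all) l := by
  obtain ⟨x, hx⟩ := exists_notMem_of_length_lt (l := (Sim.after D τ all l).used ++ [a])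
    (by simp only [List.length_append, Sim.length_used_after, List.length_singleton]; omega)
  have : simStrategy D τ all l a ∉ (Sim.after D τ all l).used ++ [a] :=
    pickFresh_notMem ⟨x, List.mem_cons_of_mem _ (hall x), hx⟩
  simp only [List.mem_append, Sim.mem_used_after, not_or] at this ⊢
  tauto

/-- The strategy obtained by the simulation, as a strategy of the second player. -/
noncomputable def simSecond [Finite V₁] (D : Responder (G₀.edgeSet ⊕ G₁.edgeSet))
    (S₀ : SecondStrategy G₀) (all : List G₁.edgeSet) (hall : ∀ e, e ∈ all) : SecondStrategy G₁ :=
  ⟨simStrategy D S₀.1 all, fun l a _ => simStrategy_legal D S₀.1 hall l a⟩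

/-- If the duplicator survives as many rounds as there are entries in a list of distinct vertices of
the first graph, then the second graph has at least as many vertices. -/
theorem le_card_of_le_efGuarantee {W₀ W₁ : Type*} [Finite W₀] [Finite W₁] {H₀ : SimpleGraph W₀}
    {H₁ : SimpleGraph W₁} {D : Responder (W₀ ⊕ W₁)} {n : ℕ}
    (h : (n : ℕ∞) ≤ efGuarantee H₀ H₁ D) (hn : n ≤ Nat.card W₀) : n ≤ Nat.card W₁ := by
  have := Fintype.ofFinite W₀
  have := Fintype.ofFinite W₁
  rw [Nat.card_eq_fintype_card] at hn ⊢
  obtain ⟨t, -, ht⟩ := Finset.exists_subset_card_eq (s := (Finset.univ : Finset W₀)) (n := n)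
    (by simpa using hn)
  have hpos := efPosition_of_le_efGuarantee h (us := t.toList.map Sum.inl) (by simp [ht])
  set us : List (W₀ ⊕ W₁) := t.toList.map Sum.inl with hus
  have hex : ∀ x ∈ t, ∃ y, (Sum.inl x, Sum.inr y) ∈ us.zip (replies D us) := by
    intro x hx
    have hx : Sum.inl x ∈ us := by simpa [hus] using hx
    obtain ⟨i, hi, hix⟩ := List.getElem_of_mem hx
    have hmem : (us[i], (replies D us)[i]'(by rwa [length_replies])) ∈ us.zip (replies D us) := by
      rw [← List.getElem_zip (h := by simpa [length_replies] using hi)]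
      exact List.getElem_mem _
    rw [hix] at hmem
    obtain ⟨x', y', hp⟩ := hpos.1 _ hmem
    rcases hp with ⟨h1, h2⟩ | ⟨h1, h2⟩
    · dsimp only at h1 h2
      rw [h2] at hmem
      exact ⟨y', hmem⟩
    · simp at h1
  choose g hg using fun x : t => hex x x.2
  have hinj : Function.Injective g := fun x x' hxx' =>
    Subtype.ext ((hpos.2 _ (hg x) _ (hg x') x (g x) x' (g x') (Or.inl ⟨rfl, rfl⟩)
      (Or.inl ⟨rfl, rfl⟩)).1.2 hxx')
  simpa [ht] using Fintype.card_le_of_injective g hinj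

theorem exists_mem_zip_left {α β : Type*} {l : List α} {l' : List β} (h : l.length = l'.length)
    {a : α} (ha : a ∈ l) : ∃ b ∈ l', (a, b) ∈ l.zip l' := by
  obtain ⟨i, hi, rfl⟩ := List.getElem_of_mem ha
  refine ⟨l'[i]'(h ▸ hi), List.getElem_mem _, ?_⟩
  rw [← List.getElem_zip (h := by simp; omega)]
  exact List.getElem_mem _

theorem exists_mem_zip_right {α β : Type*} {l : List α} {l' : List β} (h : l.length = l'.length)
    {b : β} (hb : b ∈ l') : ∃ a ∈ l, (a, b) ∈ l.zip l' := by
  obtain ⟨i, hi, rfl⟩ := List.getElem_of_mem hb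
  refine ⟨l[i]'(h ▸ hi), List.getElem_mem _, ?_⟩
  rw [← List.getElem_zip (h := by simp; omega)]
  exact List.getElem_mem _

theorem take_starterMoves {M : Type*} (σ : Starter M) (τ : Responder M) {i j : ℕ} (h : j ≤ i) :
    (starterMoves σ τ i).take j = starterMoves σ τ j := by
  induction i, h using Nat.le_induction with
  | base => exact List.take_of_length_le (length_starterMoves σ τ j).le
  | succ i hi ih =>
    rw [starterMoves, List.take_append_of_le_length (by rwa [length_starterMoves]), ih]

theorem exists_of_mem_starterMoves {M : Type*} {σ : Starter M} {τ : Responder M} {i : ℕ} {x : M}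
    (h : x ∈ starterMoves σ τ i) :
    ∃ j < i, x = σ ((replies τ (starterMoves σ τ i)).take j) := by
  obtain ⟨j, hj, rfl⟩ := List.getElem_of_mem h
  rw [length_starterMoves] at hj
  refine ⟨j, hj, ?_⟩
  rw [← replies_take, take_starterMoves σ τ hj.le]
  have h1 := take_starterMoves σ τ (Nat.succ_le_of_lt hj)
  have h2 : (starterMoves σ τ i).take (j + 1) = (starterMoves σ τ i).take j ++ [_] :=
    (List.take_append_getElem (by rwa [length_starterMoves])).symm
  rw [Nat.succ_eq_add_one, h2, take_starterMoves σ τ hj.le, starterMoves] at h1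
  simpa using h1

/-- The rules for `σ` refer to its values on initial segments of the replies; along a play these
values are exactly its earlier moves. -/
theorem FirstStrategy.notMem_of_nodup (σ : FirstStrategy G₁) (τ : Responder G₁.edgeSet) {i : ℕ}
    (hi : 2 * i < Nat.card G₁.edgeSet) (hnd : (replies τ (starterMoves σ.1 τ i)).Nodup) :
    σ.1 (replies τ (starterMoves σ.1 τ i)) ∉ starterMoves σ.1 τ i ∧
      σ.1 (replies τ (starterMoves σ.1 τ i)) ∉ replies τ (starterMoves σ.1 τ i) := by
  obtain ⟨h1, h2⟩ := σ.2 _ hnd (by rwa [length_replies, length_starterMoves])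
  refine ⟨fun h => ?_, h1⟩
  obtain ⟨j, hj, hx⟩ := exists_of_mem_starterMoves h
  exact h2 j (by rwa [length_replies, length_starterMoves]) hx

/-- The simulation proceeds as planned: `es` and `hs` are the moves on the second graph, and the
simulated moves `fs` and `gs` on the first graph are matched with `es` and `hs`. -/
structure Sim.Sound (D : Responder (G₀.edgeSet ⊕ G₁.edgeSet)) (τ : Responder G₀.edgeSet)
    (s : Sim G₀.edgeSet G₁.edgeSet) (es hs : List G₁.edgeSet) : Prop where
  length_hs : hs.length = es.length
  length_queries : s.queries.length = es.length
  length_picks : s.picks.length = 2 * es.length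
  used : ∀ x, x ∈ s.used ↔ x ∈ es ∨ x ∈ hs
  first : ∀ p ∈ s.queries.zip es, Matched D s.picks p.1 p.2
  second : ∀ p ∈ (replies τ s.queries).zip hs, Matched D s.picks p.1 p.2
  nodup_left : (s.queries ++ replies τ s.queries).Nodup
  nodup_right : (es ++ hs).Nodup

theorem nodup_append_snoc {α : Type*} {l l' : List α} {a b : α} (h : (l ++ l').Nodup)
    (ha : a ∉ l ∧ a ∉ l') (hb : b ∉ l ++ [a] ∧ b ∉ l') : (l ++ [a] ++ (l' ++ [b])).Nodup := by
  simp only [List.nodup_append, List.mem_append, List.mem_singleton, List.nodup_singleton,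
    not_or] at *
  grind

/-- One round of the simulation. -/
theorem Sim.Sound.next {D : Responder (G₀.edgeSet ⊕ G₁.edgeSet)} {S₀ : SecondStrategy G₀}
    {all : List G₁.edgeSet} {s : Sim G₀.edgeSet G₁.edgeSet} {es hs : List G₁.edgeSet} {l : ℕ}
    (hs' : s.Sound D S₀.1 es hs) (hD : (l : ℕ∞) ≤ efGuarantee G₀.lineGraph G₁.lineGraph D)
    (hl : 2 * (es.length + 1) ≤ l) (hcard : 2 * (es.length + 1) ≤ Nat.card G₀.edgeSet)
    {e : G₁.edgeSet} (he : e ∉ es ∧ e ∉ hs) :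
    (s.next D S₀.1 all e).Sound D S₀.1 (es ++ [e]) (hs ++ [s.reply D S₀.1 all e]) := by
  have hpos₁ := efPosition_of_le_efGuarantee hD (us := s.picks ++ [Sum.inr e])
    (by simp [hs'.length_picks]; omega)
  obtain ⟨f, hf⟩ := exists_inl_of_efPosition hpos₁
  set g := S₀.1 s.queries f with hg_def
  have hpos₂ := efPosition_of_le_efGuarantee hD (us := s.picks ++ [Sum.inr e] ++ [Sum.inl g])
    (by simp [hs'.length_picks]; omega)
  obtain ⟨h, hh⟩ := exists_inr_of_efPosition hpos₂
  have lenr : (replies S₀.1 s.queries).length = hs.length := by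
    rw [length_replies, hs'.length_queries, hs'.length_hs]
  have hmf : Matched D (s.picks ++ [Sum.inr e] ++ [Sum.inl g]) f e :=
    (matched_append_inr hf).append _
  have hmg : Matched D (s.picks ++ [Sum.inr e] ++ [Sum.inl g]) g h := matched_append_inl hh
  have hfirst : ∀ p ∈ s.queries.zip es, Matched D (s.picks ++ [Sum.inr e] ++ [Sum.inl g]) p.1 p.2 :=
    fun p hp => ((hs'.first p hp).append _).append _
  have hsecond : ∀ p ∈ (replies S₀.1 s.queries).zip hs,
      Matched D (s.picks ++ [Sum.inr e] ++ [Sum.inl g]) p.1 p.2 :=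
    fun p hp => ((hs'.second p hp).append _).append _
  -- If `f` were colored already, it would be matched both with an earlier colored edge and with the
  -- uncolored `e`, contrary to the matching being one-to-one. The argument for `h` below is the
  -- mirror image.
  have hf_new : f ∉ s.queries ∧ f ∉ replies S₀.1 s.queries := by
    constructor
    · intro hmem
      obtain ⟨e', he', hz⟩ := exists_mem_zip_left hs'.length_queries hmem
      exact he.1 ((hmf.partialIso hpos₂ (hfirst _ hz)).1.1 rfl ▸ he')
    · intro hmem
      obtain ⟨e', he', hz⟩ := exists_mem_zip_left lenr hmem
      exact he.2 ((hmf.partialIso hpos₂ (hsecond _ hz)).1.1 rfl ▸ he')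
  have hnd := hs'.nodup_left
  have hg_new : g ∉ s.queries ++ [f] ∧ g ∉ replies S₀.1 s.queries :=
    S₀.2 s.queries f (by
      rw [List.nodup_append] at hnd
      rw [List.nodup_append]
      refine ⟨hnd.1, by simp, ?_⟩
      rintro a ha b hb rfl
      rw [List.mem_singleton] at hb
      exact hf_new.1 (hb ▸ ha)) (by rwa [hs'.length_queries])
  have hh_new : h ∉ es ++ [e] ∧ h ∉ hs := by
    simp only [List.mem_append, List.mem_singleton, not_or] at hg_new ⊢
    refine ⟨⟨fun hmem => ?_, fun hmem => ?_⟩, fun hmem => ?_⟩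
    · obtain ⟨f', hf', hz⟩ := exists_mem_zip_right hs'.length_queries hmem
      exact hg_new.1.1 ((hmg.partialIso hpos₂ (hfirst _ hz)).1.2 rfl ▸ hf')
    · exact hg_new.1.2 ((hmg.partialIso hpos₂ hmf).1.2 hmem)
    · obtain ⟨g', hg', hz⟩ := exists_mem_zip_right lenr hmem
      exact hg_new.2 ((hmg.partialIso hpos₂ (hsecond _ hz)).1.2 rfl ▸ hg')
  have hcand : s.candidate D S₀.1 e = h := by
    simp only [Sim.candidate, hf]
    rw [← hg_def, hh, Sum.elim_inr, id]
  have hreply : s.reply D S₀.1 all e = h := by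
    rw [Sim.reply, hcand]
    refine pickFresh_cons_of_notMem ?_
    simp only [List.mem_append, hs'.used, List.mem_singleton] at hh_new ⊢
    tauto
  have hpicks : (s.next D S₀.1 all e).picks = s.picks ++ [Sum.inr e] ++ [Sum.inl g] := by
    simp [Sim.next, Sim.nextPicks, hf, hg_def]
  have hqueries : (s.next D S₀.1 all e).queries = s.queries ++ [f] := by
    simp [Sim.next, Sim.nextQueries, hf]
  have hzip : (s.queries ++ [f]).zip (es ++ [e]) = s.queries.zip es ++ [(f, e)] := by
    rw [List.zip_append hs'.length_queries]; rfl
  have hzip' : (replies S₀.1 s.queries ++ [g]).zip (hs ++ [h]) =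
      (replies S₀.1 s.queries).zip hs ++ [(g, h)] := by
    rw [List.zip_append lenr]; rfl
  refine ⟨?_, ?_, ?_, ?_, ?_, ?_, ?_, ?_⟩
  · simp [hs'.length_hs]
  · simp [hqueries, hs'.length_queries]
  · simp [hpicks, hs'.length_picks]; ring
  · intro x
    simp only [Sim.next, List.mem_append, hs'.used, List.mem_singleton]
    tauto
  · rw [hqueries, hpicks, hzip]
    intro p hp
    rcases List.mem_append.1 hp with hp | hp
    · exact hfirst p hp
    · rw [List.mem_singleton.1 hp]; exact hmf
  · rw [hqueries, hpicks, replies_append_singleton, hreply, hzip']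
    intro p hp
    rcases List.mem_append.1 hp with hp | hp
    · exact hsecond p hp
    · rw [List.mem_singleton.1 hp]; exact hmg
  · rw [hqueries, replies_append_singleton]
    exact nodup_append_snoc hnd hf_new hg_new
  · rw [hreply]
    exact nodup_append_snoc hs'.nodup_right he hh_new

/-- The simulation preserves guarantees. -/
theorem le_symGuarantee_simSecond [Finite V₀] [Finite V₁] (hG₁ : G₁.CliqueFree 3)
    {D : Responder (G₀.edgeSet ⊕ G₁.edgeSet)} {S₀ : SecondStrategy G₀} {all : List G₁.edgeSet}
    (hall : ∀ e, e ∈ all) {l m : ℕ} (hD : (l : ℕ∞) ≤ efGuarantee G₀.lineGraph G₁.lineGraph D)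
    (hS₀ : m ≤ symGuarantee S₀) : min (l / 2) m ≤ symGuarantee (simSecond D S₀ all hall) := by
  set k := min (l / 2) m with hk
  have hkl : 2 * k ≤ l := by omega
  have hkm : k ≤ m := by omega
  have hcard₀ : 2 * k ≤ Nat.card G₀.edgeSet := by
    have := symGuarantee_le S₀
    omega
  -- The game on `G₁` must be long enough to have `k` rounds: a spoiler picking `2 * k` distinct
  -- edges of `G₀` forces as many distinct edges of `G₁`.
  have hcard₁ : 2 * k ≤ Nat.card G₁.edgeSet :=
    le_card_of_le_efGuarantee ((Nat.cast_le.2 hkl).trans hD) hcard₀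
  rcases Nat.eq_zero_or_pos k with h0 | h0
  · rw [h0]; exact Nat.zero_le _
  have : Nonempty G₁.edgeSet := (Nat.card_pos_iff.1 (by omega : 0 < Nat.card G₁.edgeSet)).1
  have := nonempty_firstStrategy (G := G₁)
  refine le_ciInf fun σ => le_symRounds_iff.2 ⟨by omega, fun i hi => ?_⟩
  set S : Responder G₁.edgeSet := simStrategy D S₀.1 all with hS
  change IsoEdges (starterMoves σ.1 S i) (replies S (starterMoves σ.1 S i))
  have hsound : (Sim.after D S₀.1 all (starterMoves σ.1 S i)).Sound D S₀.1 (starterMoves σ.1 S i)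
      (replies S (starterMoves σ.1 S i)) := by
    induction i with
    | zero =>
      refine ⟨?_, ?_, ?_, ?_, ?_, ?_, ?_, ?_⟩ <;> simp [starterMoves, Sim.after, Sim.start]
    | succ i ih =>
      specialize ih (by omega)
      have hnd := ih.nodup_right
      rw [starterMoves, replies_append_singleton, Sim.after_append]
      refine ih.next hD (by rw [length_starterMoves]; omega) (by rw [length_starterMoves]; omega)
        (σ.notMem_of_nodup S (by omega) (List.nodup_append.1 hnd).2.1)
  have hpos := efPosition_of_le_efGuarantee hD
    (us := (Sim.after D S₀.1 all (starterMoves σ.1 S i)).picks)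
    (by rw [hsound.length_picks, length_starterMoves]; omega)
  have lenr : (replies S₀.1 (Sim.after D S₀.1 all (starterMoves σ.1 S i)).queries).length =
      (replies S (starterMoves σ.1 S i)).length := by
    rw [length_replies, hsound.length_queries, length_replies]
  refine IsoEdges.transfer hG₁ (fun x y x' y' h h' => Matched.partialIso hpos h h')
    (fun f hf => ?_) (fun e he => ?_) (fun g hg => ?_) (fun h hh => ?_)
    (isoEdges_of_le_symGuarantee hS₀ (by rw [hsound.length_queries, length_starterMoves]; omega)
      hsound.nodup_left)
  · obtain ⟨e, he, hz⟩ := exists_mem_zip_left hsound.length_queries hf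
    exact ⟨e, he, hsound.first _ hz⟩
  · obtain ⟨f, hf, hz⟩ := exists_mem_zip_right hsound.length_queries he
    exact ⟨f, hf, hsound.first _ hz⟩
  · obtain ⟨h, hh, hz⟩ := exists_mem_zip_left lenr hg
    exact ⟨h, hh, hsound.second _ hz⟩
  · obtain ⟨g, hg, hz⟩ := exists_mem_zip_right lenr hh
    exact ⟨g, hg, hsound.second _ hz⟩

/-- It suffices to treat finite `l` below the Ehrenfeucht–Fraïssé length, where a strategy with
guarantee `l` exists; if the length is infinite, `l = 2 * symLength G₀` is large enough. -/
theorem min_efLength_symLength_le [Finite V₀] [Finite V₁] (hG₁ : G₁.CliqueFree 3) :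
    min (ENat.map (fun l : ℕ => l / 2) (efLength G₀.lineGraph G₁.lineGraph) : ℕ∞)
      (symLength G₀ : ℕ∞) ≤ (symLength G₁ : ℕ∞) := by
  rcases Nat.eq_zero_or_pos (symLength G₀) with h0 | h0
  · exact (min_le_right _ _).trans ((Nat.cast_le (α := ℕ∞)).2 (by omega))
  obtain ⟨S₀, hS₀⟩ := exists_symGuarantee_eq_symLength h0
  have hne := nonempty_edgeSet_of_pos_symGuarantee (hS₀.symm ▸ h0)
  have := Fintype.ofFinite G₁.edgeSet
  have key : ∀ l : ℕ, (l : ℕ∞) ≤ efLength G₀.lineGraph G₁.lineGraph →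
      min (l / 2) (symLength G₀) ≤ symLength G₁ := by
    intro l hl
    obtain ⟨D, hD⟩ := exists_le_efGuarantee hl ⟨Sum.inl hne.some⟩
    exact (le_symGuarantee_simSecond hG₁ (all := Finset.univ.toList) (by simp) hD hS₀.ge).trans
      (symGuarantee_le_symLength _)
  cases hE : efLength G₀.lineGraph G₁.lineGraph with
  | top =>
    have := key (2 * symLength G₀) (by rw [hE]; exact le_top)
    exact (min_le_right _ _).trans ((Nat.cast_le (α := ℕ∞)).2 (by omega))
  | coe l =>
    rcases min_le_iff.1 (key l hE.ge) with h | h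
    · refine (min_le_left _ _).trans ?_
      rw [ENat.map_natCast]
      exact (Nat.cast_le (α := ℕ∞)).2 h
    · exact (min_le_right _ _).trans ((Nat.cast_le (α := ℕ∞)).2 h)

end Guarantee

/-! ### Bit lengths of words -/

section BitLength

@[simp]
theorem bitLength_nil : bitLength [] = 0 := rfl

theorem bitLength_cons (x : ℕ) (w : List ℕ) : bitLength (x :: w) = x.size + 1 + bitLength w := by
  simp [bitLength]

theorem bitLength_append (v w : List ℕ) : bitLength (v ++ w) = bitLength v + bitLength w := by
  simp [bitLength]

theorem bitLength_tail_le (w : List ℕ) : bitLength w.tail ≤ bitLength w := by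
  cases w with
  | nil => simp
  | cons x w => rw [List.tail_cons, bitLength_cons]; omega

theorem bitLength_take_one_le (w : List ℕ) : bitLength (w.take 1) ≤ bitLength w := by
  cases w with
  | nil => simp
  | cons x w => simp [bitLength_cons]

theorem length_le_bitLength (w : List ℕ) : w.length ≤ bitLength w := by
  induction w with
  | nil => simp
  | cons x w ih => rw [bitLength_cons, List.length_cons]; omega

theorem bitLength_flatMap_le {α : Type*} {f : α → List ℕ} {q : ℕ} (hf : ∀ x, bitLength (f x) ≤ q)
    (l : List α) : bitLength (l.flatMap f) ≤ l.length * q := by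
  induction l with
  | nil => simp
  | cons x l ih =>
    rw [List.flatMap_cons, bitLength_append, List.length_cons, Nat.succ_mul]
    have := hf x
    omega

end BitLength

/-! ### Cost bounds for programs -/

section Programs

variable {O : Oracles}

/-- All registers hold words of bit length at most `N`. -/
def Bdd (N : ℕ) (s : Store) : Prop := ∀ r, bitLength (s r) ≤ N

/-- The program `P` started in `s` halts in `s'` at cost at most `T`. -/
def Runs (O : Oracles) (P : Prog) (s : Store) (T : ℕ) (s' : Store) : Prop :=
  ∃ t ≤ T, Exec O P s t s'

theorem Runs.mono {P : Prog} {s s' : Store} {T T' : ℕ} (h : Runs O P s T s') (hT : T ≤ T') :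
    Runs O P s T' s' := by
  obtain ⟨t, ht, h⟩ := h
  exact ⟨t, ht.trans hT, h⟩

theorem Runs.seq {P Q : Prog} {s s₁ s₂ : Store} {T₁ T₂ : ℕ} (h₁ : Runs O P s T₁ s₁)
    (h₂ : Runs O Q s₁ T₂ s₂) : Runs O (.seq P Q) s (T₁ + T₂) s₂ := by
  obtain ⟨t₁, ht₁, h₁⟩ := h₁
  obtain ⟨t₂, ht₂, h₂⟩ := h₂
  exact ⟨_, Nat.add_le_add ht₁ ht₂, .seq h₁ h₂⟩

theorem Test.cost_le {N : ℕ} {s : Store} (hs : Bdd N s) (b : Test) : b.cost s ≤ 1 + 2 * N := by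
  cases b with
  | empty r => have := hs r; simp only [Test.cost]; omega
  | eq r r' => have := hs r; have := hs r'; simp only [Test.cost]; omega

theorem Runs.ite_true {b : Test} {P Q : Prog} {s s' : Store} {N T : ℕ} (hs : Bdd N s)
    (hb : b.Holds s) (h : Runs O P s T s') : Runs O (.ite b P Q) s (1 + 2 * N + T) s' := by
  obtain ⟨t, ht, h⟩ := h
  exact ⟨_, Nat.add_le_add (b.cost_le hs) ht, .iteTrue hb h⟩

theorem Runs.ite_false {b : Test} {P Q : Prog} {s s' : Store} {N T : ℕ} (hs : Bdd N s)
    (hb : ¬ b.Holds s) (h : Runs O Q s T s') : Runs O (.ite b P Q) s (1 + 2 * N + T) s' := by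
  obtain ⟨t, ht, h⟩ := h
  exact ⟨_, Nat.add_le_add (b.cost_le hs) ht, .iteFalse hb h⟩

theorem Runs.until_done {b : Test} {P : Prog} {s : Store} {N : ℕ} (hs : Bdd N s)
    (hb : b.Holds s) : Runs O (.untilDo b P) s (1 + 2 * N) s :=
  ⟨_, b.cost_le hs, .untilStop hb⟩

theorem Runs.until_step {b : Test} {P : Prog} {s s₁ s₂ : Store} {N T₁ T₂ : ℕ} (hs : Bdd N s)
    (hb : ¬ b.Holds s) (h₁ : Runs O P s T₁ s₁) (h₂ : Runs O (.untilDo b P) s₁ T₂ s₂) :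
    Runs O (.untilDo b P) s (1 + 2 * N + T₁ + T₂) s₂ := by
  obtain ⟨t₁, ht₁, h₁⟩ := h₁
  obtain ⟨t₂, ht₂, h₂⟩ := h₂
  exact ⟨_, Nat.add_le_add (Nat.add_le_add (b.cost_le hs) ht₁) ht₂, .untilStep hb h₁ h₂⟩

/-- Instructions that move words around and load words of bit length at most two. -/
def Instr.Plain : Instr → Prop
  | load _ w => bitLength w ≤ 2
  | copy _ _ => True
  | append _ _ => True
  | shift _ _ => True
  | _ => False

/-- Appending can at most double the longest register, and the loaded words fit into `2 ≤ N`. -/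
theorem Instr.Plain.bdd_run {c : Instr} (hc : c.Plain) {N : ℕ} (hN : 2 ≤ N) {s : Store}
    (hs : Bdd N s) : Bdd (2 * N) (c.run O s) := by
  intro r
  have h := hs r
  cases c with
  | load r' w =>
    simp only [Instr.Plain] at hc
    simp only [Instr.run, Function.update_apply]
    split_ifs <;> omega
  | copy src dst =>
    have := hs src
    simp only [Instr.run, Function.update_apply]
    split_ifs <;> omega
  | append src dst =>
    have := hs src
    have := hs dst
    simp only [Instr.run, Function.update_apply]
    split_ifs
    · rw [bitLength_append]; omega
    · omega
  | shift src dst =>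
    have h1 := hs src
    have h2 := hs dst
    have h3 := bitLength_tail_le (s src)
    have h4 := bitLength_take_one_le (s src)
    simp only [Instr.run, Function.update_apply]
    split_ifs <;> (try rw [bitLength_append]) <;> omega
  | succ r => exact hc.elim
  | double r => exact hc.elim
  | half r => exact hc.elim
  | ask k src dst => exact hc.elim

theorem Instr.cost_le {N : ℕ} {s : Store} (c : Instr) (hs : Bdd N s) (hs' : Bdd N (c.run O s)) :
    c.cost O s ≤ 1 + 4 * N := by
  have h := fun r => Nat.add_le_add (hs r) (hs' r)
  cases c <;> simp only [Instr.cost, Instr.regs, List.map_cons, List.map_nil, List.sum_cons,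
    List.sum_nil]
  case load r w => have := h r; omega
  case copy a b => have := h a; have := h b; omega
  case append a b => have := h a; have := h b; omega
  case shift a b => have := h a; have := h b; omega
  case succ r => have := h r; omega
  case double r => have := h r; omega
  case half r => have := h r; omega
  case ask k a b => have := h a; have := h b; omega

/-- Straight-line programs. -/
def block : List Instr → Prog
  -- There is no empty program; copying a register to itself leaves the store unchanged.
  | [] => .basic (.copy 0 0)
  | c :: cs => .seq (.basic c) (block cs)

/-- The store after a straight-line program. -/
def runBlock (O : Oracles) (cs : List Instr) (s : Store) : Store :=
  cs.foldl (fun s c => c.run O s) s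

/-- An instruction costs at most `1 + 4 * (2 * N) ≤ 9 * N` and doubles the size bound, whence the
power of two. It is a constant, since blocks are fixed program text. -/
theorem runs_block_pow {cs : List Instr} (hcs : ∀ c ∈ cs, c.Plain) {N : ℕ} (hN : 2 ≤ N)
    {s : Store} (hs : Bdd N s) :
    Runs O (block cs) s ((cs.length + 1) * (9 * 2 ^ cs.length * N)) (runBlock O cs s) := by
  induction cs generalizing s N with
  | nil =>
    have h : (Instr.copy 0 0).run O s = s := by simp [Instr.run]
    refine ⟨_, ?_, by
      have := Exec.basic (O := O) (Instr.copy 0 0) s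
      rw [h] at this
      exact this⟩
    have := Instr.cost_le (O := O) (Instr.copy 0 0) hs (by rwa [h])
    simp only [List.length_nil, pow_zero]
    omega
  | cons c cs ih =>
    have hc := hcs c (by simp)
    have hs' := hc.bdd_run (O := O) hN hs
    have h1 : Runs O (.basic c) s (9 * N) (c.run O s) := by
      refine ⟨_, ?_, .basic c s⟩
      have := c.cost_le (N := 2 * N) (fun r => (hs r).trans (by omega)) hs'
      omega
    refine (h1.seq (ih (fun c hc => hcs c (by simp [hc])) (by omega) hs')).mono ?_
    rw [List.length_cons, pow_succ]
    have : 1 ≤ 2 ^ cs.length := Nat.one_le_two_pow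
    nlinarith [Nat.mul_le_mul_right N this]

/-- A short straight-line program has linear cost. -/
theorem runs_block {cs : List Instr} (hcs : ∀ c ∈ cs, c.Plain) (hlen : cs.length ≤ 7) {N : ℕ}
    (hN : 2 ≤ N) {s : Store} (hs : Bdd N s) :
    Runs O (block cs) s (10000 * N) (runBlock O cs s) := by
  refine (runs_block_pow hcs hN hs).mono ?_
  have h1 : 2 ^ cs.length ≤ 2 ^ 7 := Nat.pow_le_pow_right (by norm_num) hlen
  -- The constant is `8 * 9 * 2 ^ 7 = 9216`; the longest block, in `queryPart`, has seven
  -- instructions.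
  calc (cs.length + 1) * (9 * 2 ^ cs.length * N) ≤ 8 * (9 * 2 ^ 7 * N) := by gcongr; omega
    _ ≤ 10000 * N := by omega

/-- The register changed by an instruction, with the source of a shift. -/
def Instr.writes : Instr → List ℕ
  | load r _ => [r]
  | copy _ dst => [dst]
  | append _ dst => [dst]
  | shift src dst => [src, dst]
  | succ r => [r]
  | double r => [r]
  | half r => [r]
  | ask _ _ dst => [dst]

theorem Instr.run_apply_of_notMem {c : Instr} {s : Store} {r : ℕ} (h : r ∉ c.writes) :
    c.run O s r = s r := by
  cases c <;> simp_all [Instr.run, Instr.writes, Function.update_apply]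

theorem runBlock_apply_of_notMem {cs : List Instr} {s : Store} {r : ℕ}
    (h : r ∉ cs.flatMap Instr.writes) : runBlock O cs s r = s r := by
  induction cs generalizing s with
  | nil => rfl
  | cons c cs ih =>
    rw [List.flatMap_cons, List.mem_append, not_or] at h
    exact (ih h.2).trans (Instr.run_apply_of_notMem h.1)

/-- After each block the same bound `N` is recovered from the known contents of the few changed
registers, so the doubling inside blocks does not accumulate over loops. -/
theorem Bdd.of_frame {N : ℕ} {s s' : Store} (hs : Bdd N s) (W : List ℕ)
    (hframe : ∀ r, r ∉ W → s' r = s r) (hW : ∀ r ∈ W, bitLength (s' r) ≤ N) : Bdd N s' := by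
  intro r
  by_cases h : r ∈ W
  · exact hW r h
  · rw [hframe r h]; exact hs r

theorem runs_ask {k : Fin 2} {src dst N : ℕ} {s : Store} (hN : 1 ≤ N) (hs : Bdd N s)
    (ha : bitLength (O k (s src)) ≤ N) :
    Runs O (.basic (.ask k src dst)) s (5 * N) (Function.update s dst (O k (s src))) := by
  refine ⟨_, ?_, .basic _ s⟩
  have := (Instr.ask k src dst).cost_le (O := O) hs (fun r => by
    simp only [Instr.run, Function.update_apply]
    split_ifs
    · exact ha
    · exact hs r)
  omega

end Programs

/-! ### Encodings of edges and graphs -/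

section Encoding

variable {n : ℕ} {G : SimpleGraph (Fin n)}

theorem encodeEdge_injective : Function.Injective (encodeEdge (G := G)) := by
  intro e f h
  simp only [encodeEdge, List.cons.injEq, and_true] at h
  exact Subtype.ext (Sym2.inf_eq_inf_and_sup_eq_sup.1 ⟨Fin.ext h.1, Fin.ext h.2⟩)

theorem encodeEdges_cons (e : G.edgeSet) (l : List G.edgeSet) :
    encodeEdges (e :: l) = encodeEdge e ++ encodeEdges l := rfl

@[simp]
theorem encodeEdges_nil : encodeEdges ([] : List G.edgeSet) = [] := rfl

theorem encodeEdges_append (l l' : List G.edgeSet) :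
    encodeEdges (l ++ l') = encodeEdges l ++ encodeEdges l' := by
  simp [encodeEdges]

theorem encodeEdges_singleton (e : G.edgeSet) : encodeEdges [e] = encodeEdge e := by
  simp [encodeEdges]

theorem bitLength_encodeEdge_le (e : G.edgeSet) : bitLength (encodeEdge e) ≤ 2 * (n.size + 1) := by
  have h1 := Nat.size_le_size (Sym2.inf (e : Sym2 (Fin n))).isLt.le
  have h2 := Nat.size_le_size (Sym2.sup (e : Sym2 (Fin n))).isLt.le
  simp only [encodeEdge, bitLength_cons, bitLength_nil]
  omega

theorem length_le_bitLength_encodeEdges (l : List G.edgeSet) :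
    l.length ≤ bitLength (encodeEdges l) := by
  refine le_trans ?_ (length_le_bitLength _)
  induction l with
  | nil => simp
  | cons e l ih =>
    rw [encodeEdges_cons, List.length_append, List.length_cons]
    simp only [encodeEdge, List.length_cons]
    omega

theorem exists_encodeEdges_eq (L : List (Fin n × Fin n))
    (hL : ∀ p ∈ L, p.1 < p.2 ∧ G.Adj p.1 p.2) :
    ∃ all : List G.edgeSet, encodeEdges all = L.flatMap (fun p => [(p.1 : ℕ), (p.2 : ℕ)]) ∧
      ∀ p ∈ L, ∃ e ∈ all, (e : Sym2 (Fin n)) = s(p.1, p.2) := by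
  induction L with
  | nil => exact ⟨[], rfl, by simp⟩
  | cons p L ih =>
    obtain ⟨all, h1, h2⟩ := ih fun q hq => hL q (List.mem_cons_of_mem _ hq)
    obtain ⟨hlt, hadj⟩ := hL p List.mem_cons_self
    refine ⟨⟨s(p.1, p.2), hadj⟩ :: all, ?_, ?_⟩
    · rw [encodeEdges_cons, h1, List.flatMap_cons]
      simp [encodeEdge, Sym2.inf_mk, Sym2.sup_mk, hlt.le]
    · intro q hq
      rcases List.mem_cons.1 hq with rfl | hq
      · exact ⟨_, List.mem_cons_self, rfl⟩
      · obtain ⟨e, he, heq⟩ := h2 q hq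
        exact ⟨e, List.mem_cons_of_mem _ he, heq⟩

/-- The encoding of the graph without its first number serves directly as the list `all` of fallback
edges. -/
theorem exists_encodeGraph_eq (G : SimpleGraph (Fin n)) :
    ∃ all : List G.edgeSet, (∀ e, e ∈ all) ∧ encodeGraph G = n :: encodeEdges all := by
  classical
  obtain ⟨all, h1, h2⟩ := exists_encodeEdges_eq (G := G)
    ((List.finRange n ×ˢ List.finRange n).filter fun p => p.1 < p.2 ∧ G.Adj p.1 p.2)
    (fun p hp => by simpa using (List.mem_filter.1 hp).2)
  refine ⟨all, ?_, ?_⟩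
  · rintro ⟨e, he⟩
    induction e using Sym2.ind with | _ u v => ?_
    rcases lt_trichotomy u v with huv | huv | huv
    · obtain ⟨e, h, heq⟩ := h2 (u, v) (by simpa [huv] using he)
      exact (Subtype.ext heq : e = ⟨s(u, v), he⟩) ▸ h
    · exact (G.ne_of_adj he huv).elim
    · obtain ⟨e, h, heq⟩ := h2 (v, u) (by simpa [huv] using SimpleGraph.Adj.symm he)
      exact (Subtype.ext (heq.trans Sym2.eq_swap) : e = ⟨s(u, v), he⟩) ▸ h
  · rw [h1, encodeGraph]

end Encoding

/-! ### Finding the first uncolored edge -/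

section Search

variable {O : Oracles} {n : ℕ} {G : SimpleGraph (Fin n)}

/-- Compare the first edge of register 12 with the edge in register 10; on equality set the flag in
register 13. -/
def searchBody : Prog :=
  .seq (block [.load 14 [], .shift 12 14, .shift 12 14])
    (.ite (.eq 14 10) (block [.load 13 [1]]) (block []))

/-- Look for the edge in register 10 among the edges in register 12. -/
def search : Prog := .untilDo (.empty 12) searchBody

theorem searchBody_spec {N : ℕ} (hN : 2 ≤ N) {s : Store} (hs : Bdd N s) {x c : G.edgeSet}
    {w : List ℕ} (h12 : s 12 = encodeEdge x ++ w) (h10 : s 10 = encodeEdge c) :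
    ∃ s', Runs O searchBody s (20003 * N) s' ∧ s' 12 = w ∧ (s' 13 = [] ↔ s 13 = [] ∧ c ≠ x) ∧
      (∀ r, r ∉ [12, 13, 14] → s' r = s r) ∧ Bdd N s' := by
  classical
  have h1 := runs_block (O := O) (cs := [.load 14 [], .shift 12 14, .shift 12 14])
    (by simp [Instr.Plain]) (by simp) hN hs
  obtain ⟨s₁, hs₁⟩ : ∃ s₁, s₁ = runBlock O [.load 14 [], .shift 12 14, .shift 12 14] s := ⟨_, rfl⟩
  rw [← hs₁] at h1
  have f1 : ∀ r, r ∉ [12, 14] → s₁ r = s r := fun r hr => by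
    rw [hs₁]
    refine runBlock_apply_of_notMem ?_
    simp only [List.mem_cons, List.not_mem_nil, or_false, not_or] at hr
    simp [Instr.writes, hr]
  have e12 : s₁ 12 = w := by
    simp [hs₁, runBlock, Instr.run, Function.update_apply, h12, encodeEdge]
  have e14 : s₁ 14 = encodeEdge x := by
    simp [hs₁, runBlock, Instr.run, Function.update_apply, h12, encodeEdge]
  have hx12 := hs 12
  rw [h12, bitLength_append] at hx12
  have b1 : Bdd N s₁ := hs.of_frame _ f1 (by simp [e12, e14]; omega)
  by_cases hxc : c = x
  · have h2 := runs_block (O := O) (cs := [.load 13 [1]]) (by simp [Instr.Plain, bitLength])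
      (by simp) hN b1
    refine ⟨_, (h1.seq (Runs.ite_true b1 ?_ h2)).mono (by omega), ?_, ?_, ?_, ?_⟩
    · simp [Test.Holds, e14, f1, h10, hxc]
    · simp [runBlock, Instr.run, e12]
    · simp [runBlock, Instr.run, hxc]
    · intro r hr
      simp only [List.mem_cons, List.not_mem_nil, or_false, not_or] at hr
      simp [runBlock, Instr.run, hr, f1]
    · exact b1.of_frame [13] (fun r hr => runBlock_apply_of_notMem (by simpa [Instr.writes] using hr))
        (by simp [runBlock, Instr.run, bitLength, hN])
  · have h2 := runs_block (O := O) (cs := []) (by simp) (by simp) hN b1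
    refine ⟨s₁, (h1.seq (Runs.ite_false b1 ?_ h2)).mono (by omega), e12, ?_, ?_, b1⟩
    · simp only [Test.Holds, e14, f1 10 (by simp), h10]
      exact fun h => hxc (encodeEdge_injective h).symm
    · simp [f1, hxc]
    · intro r hr
      simp only [List.mem_cons, List.not_mem_nil, or_false, not_or] at hr
      simp [hr, f1]

/-- The flag is set at a hit and never cleared, and the scan always runs to the end of the list. -/
theorem search_spec {N : ℕ} (hN : 2 ≤ N) (us : List G.edgeSet) {c : G.edgeSet} {s : Store}
    (hs : Bdd N s) (h12 : s 12 = encodeEdges us) (h10 : s 10 = encodeEdge c) :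
    ∃ s', Runs O search s ((us.length + 1) * (20010 * N)) s' ∧
      (s' 13 = [] ↔ s 13 = [] ∧ c ∉ us) ∧ (∀ r, r ∉ [12, 13, 14] → s' r = s r) ∧ Bdd N s' := by
  induction us generalizing s with
  | nil =>
    exact ⟨s, (Runs.until_done (b := .empty 12) hs h12).mono (by simp; omega), by simp, by simp, hs⟩
  | cons x us ih =>
    obtain ⟨s₁, hr₁, h12₁, h13₁, f₁, b₁⟩ := searchBody_spec (O := O) hN hs h12 h10
    obtain ⟨s₂, hr₂, h13₂, f₂, b₂⟩ := ih b₁ h12₁ (by rw [f₁ 10 (by simp), h10])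
    refine ⟨s₂, (Runs.until_step hs ?_ hr₁ hr₂).mono ?_, ?_, ?_, b₂⟩
    · simp [Test.Holds, h12, encodeEdges_cons, encodeEdge]
    · rw [List.length_cons, Nat.succ_mul (us.length + 1)]; omega
    · rw [h13₂, h13₁, List.mem_cons, not_or, and_assoc]
    · exact fun r hr => (f₂ r hr).trans (f₁ r hr)

/-- Move the first edge of register 11 to register 10; empty register 11 if this edge is not among
the edges in register 4. -/
def selectBody : Prog :=
  .seq (block [.load 10 [], .shift 11 10, .shift 11 10, .copy 4 12, .load 13 []])
    (.seq search (.ite (.empty 13) (block [.load 11 []]) (block [])))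

/-- Find the first edge in register 11 that is not among the edges in register 4. -/
def select : Prog := .untilDo (.empty 11) selectBody

/-- Emptying register 11 is the exit from the loop `select`: the fresh edge then remains in register
10. -/
theorem selectBody_spec {N : ℕ} (hN : 2 ≤ N) {us : List G.edgeSet} {c : G.edgeSet} {w : List ℕ}
    {s : Store} (hs : Bdd N s) (h11 : s 11 = encodeEdge c ++ w) (h4 : s 4 = encodeEdges us) :
    ∃ s', Runs O selectBody s ((us.length + 2) * (20020 * N)) s' ∧ s' 10 = encodeEdge c ∧
      (c ∈ us → s' 11 = w) ∧ (c ∉ us → s' 11 = []) ∧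
      (∀ r, r ∉ [10, 11, 12, 13, 14] → s' r = s r) ∧ Bdd N s' := by
  have h1 := runs_block (O := O)
    (cs := [.load 10 [], .shift 11 10, .shift 11 10, .copy 4 12, .load 13 []])
    (by simp [Instr.Plain]) (by simp) hN hs
  obtain ⟨s₁, hs₁⟩ : ∃ s₁, s₁ = runBlock O
    [.load 10 [], .shift 11 10, .shift 11 10, .copy 4 12, .load 13 []] s := ⟨_, rfl⟩
  rw [← hs₁] at h1
  have f1 : ∀ r, r ∉ [10, 11, 12, 13] → s₁ r = s r := fun r hr => by
    rw [hs₁]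
    refine runBlock_apply_of_notMem ?_
    simp only [List.mem_cons, List.not_mem_nil, or_false, not_or] at hr
    simp [Instr.writes, hr]
  have e10 : s₁ 10 = encodeEdge c := by
    simp [hs₁, runBlock, Instr.run, Function.update_apply, h11, encodeEdge]
  have e11 : s₁ 11 = w := by
    simp [hs₁, runBlock, Instr.run, Function.update_apply, h11, encodeEdge]
  have e12 : s₁ 12 = encodeEdges us := by
    simp [hs₁, runBlock, Instr.run, Function.update_apply, h4]
  have e13 : s₁ 13 = [] := by
    simp [hs₁, runBlock, Instr.run, Function.update_apply]
  have hx11 := hs 11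
  rw [h11, bitLength_append] at hx11
  have hx4 := hs 4
  rw [h4] at hx4
  have b1 : Bdd N s₁ := hs.of_frame _ f1 (by simp [e10, e11, e12, e13]; omega)
  obtain ⟨s₂, hr₂, h13₂, f₂, b₂⟩ := search_spec (O := O) hN us b1 e12 e10
  rw [e13] at h13₂
  have f12 : ∀ r, r ∉ [10, 11, 12, 13, 14] → s₂ r = s r := fun r hr => by
    simp only [List.mem_cons, List.not_mem_nil, or_false, not_or] at hr
    rw [f₂ r (by simp [hr]), f1 r (by simp [hr])]
  have hT : 10000 * N + ((us.length + 1) * (20010 * N) + (1 + 2 * N + 10000 * N)) ≤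
      (us.length + 2) * (20020 * N) := by
    nlinarith [Nat.zero_le (us.length * N)]
  by_cases hc : c ∈ us
  · have h3 := runs_block (O := O) (cs := []) (by simp) (by simp) hN b₂
    refine ⟨s₂, (h1.seq (hr₂.seq (Runs.ite_false b₂ ?_ h3))).mono hT, ?_, fun _ => ?_,
      fun h => (h hc).elim, f12, b₂⟩
    · simp [Test.Holds, h13₂, hc]
    · rw [f₂ 10 (by simp), e10]
    · rw [f₂ 11 (by simp), e11]
  · have h3 := runs_block (O := O) (cs := [.load 11 []]) (by simp [Instr.Plain]) (by simp) hN b₂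
    refine ⟨_, (h1.seq (hr₂.seq (Runs.ite_true b₂ ?_ h3))).mono hT, ?_, fun h => (hc h).elim,
      fun _ => ?_, fun r hr => ?_, ?_⟩
    · simp [Test.Holds, h13₂, hc]
    · simp [runBlock, Instr.run, f₂, e10]
    · simp [runBlock, Instr.run]
    · have hr' := hr
      simp only [List.mem_cons, List.not_mem_nil, or_false, not_or] at hr'
      simp [runBlock, Instr.run, hr', f12]
    · exact b₂.of_frame [11] (fun r hr => runBlock_apply_of_notMem (by simpa [Instr.writes] using hr))
        (by simp [runBlock, Instr.run])

/-- The loop follows the recursion of `pickFresh`, with register 10 in the role of its default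
argument. -/
theorem select_spec {N : ℕ} (hN : 2 ≤ N) {us : List G.edgeSet} (cs : List G.edgeSet) {c : G.edgeSet}
    {s : Store} (hs : Bdd N s) (h10 : s 10 = encodeEdge c) (h11 : s 11 = encodeEdges cs)
    (h4 : s 4 = encodeEdges us) :
    ∃ s', Runs O select s ((cs.length + 1) * ((us.length + 2) * (20030 * N))) s' ∧
      s' 10 = encodeEdge (pickFresh us c cs) ∧
      (∀ r, r ∉ [10, 11, 12, 13, 14] → s' r = s r) ∧ Bdd N s' := by
  induction cs generalizing s c with
  | nil =>
    refine ⟨s, (Runs.until_done (b := .empty 11) hs h11).mono ?_, h10, fun _ _ => rfl, hs⟩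
    simp only [List.length_nil]
    nlinarith [Nat.zero_le (us.length * N)]
  | cons x cs ih =>
    obtain ⟨s₁, hr₁, e10, e11, e11', f₁, b₁⟩ := selectBody_spec (O := O) hN hs h11 h4
    have hne : ¬ (Test.empty 11).Holds s := by
      simp [Test.Holds, h11, encodeEdges_cons, encodeEdge]
    by_cases hx : x ∈ us
    · obtain ⟨s₂, hr₂, h10₂, f₂, b₂⟩ := ih b₁ e10 (e11 hx) (by rw [f₁ 4 (by simp), h4])
      refine ⟨s₂, (Runs.until_step hs hne hr₁ hr₂).mono ?_, ?_,
        fun r hr => (f₂ r hr).trans (f₁ r hr), b₂⟩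
      · rw [List.length_cons, Nat.succ_mul (cs.length + 1)]
        nlinarith [Nat.zero_le (us.length * N)]
      · rw [h10₂, pickFresh, if_pos hx]
    · refine ⟨s₁, (Runs.until_step hs hne hr₁ (Runs.until_done b₁ (e11' hx))).mono ?_, ?_, f₁, b₁⟩
      · rw [List.length_cons, Nat.succ_mul (cs.length + 1)]
        nlinarith [Nat.zero_le (us.length * N), Nat.zero_le ((cs.length + 1) * ((us.length + 2) * (20030 * N)))]
      · rw [e10, pickFresh, if_neg hx]

end Search

/-! ### One round of the simulation as a program -/

section Simulate

variable {O : Oracles} {n₀ n₁ : ℕ} {G₀ : SimpleGraph (Fin n₀)} {G₁ : SimpleGraph (Fin n₁)}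
  {D : Responder (G₀.edgeSet ⊕ G₁.edgeSet)} {S₀ : SecondStrategy G₀}

/-- Having received the edge in register 6 from the duplicator, query the strategy on the first graph
and then the duplicator again; put the duplicator's edge into register 10 if it lies in the second
graph. -/
def answerPart : Prog :=
  .seq (block [.append 6 9]) (.seq (.basic (.ask 1 9 6)) (.seq (block [.append 8 5, .append 6 5])
    (.seq (.basic (.ask 0 5 6)) (.seq (block [.load 7 [], .shift 6 7, .load 8 [1]])
      (.ite (.eq 7 8) (block [.copy 6 10]) (block []))))))

/-- Read the next move from register 2 and compute the edge suggested by the simulation. -/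
def queryPart : Prog :=
  .seq (block [.load 3 [], .shift 2 3, .shift 2 3, .append 3 4, .load 8 [1], .append 8 5,
      .append 3 5])
    (.seq (.basic (.ask 0 5 6)) (.seq (block [.load 7 [], .shift 6 7, .copy 3 10, .load 8 [0]])
      (.ite (.eq 7 8) answerPart (block []))))

theorem bitLength_encodeEdge_le_encodePick_inl (f : G₀.edgeSet) :
    bitLength (encodeEdge f) ≤ bitLength (encodePick (Sum.inl f : G₀.edgeSet ⊕ G₁.edgeSet)) := by
  rw [encodePick, bitLength_cons]; omega

theorem bitLength_encodeEdge_le_encodePick_inr (f : G₁.edgeSet) :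
    bitLength (encodeEdge f) ≤ bitLength (encodePick (Sum.inr f : G₀.edgeSet ⊕ G₁.edgeSet)) := by
  rw [encodePick, bitLength_cons]; omega

theorem answerPart_spec (hO : OraclesFor D S₀ O) {N : ℕ} (hN : 2 ≤ N)
    (hA : ∀ u : G₀.edgeSet ⊕ G₁.edgeSet, bitLength (encodePick u) ≤ N)
    {picks : List (G₀.edgeSet ⊕ G₁.edgeSet)} {queries : List G₀.edgeSet} {f : G₀.edgeSet}
    {e : G₁.edgeSet} {s : Store} (hs : Bdd N s) (h5 : s 5 = picks.flatMap encodePick)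
    (h6 : s 6 = encodeEdge f) (h8 : s 8 = [0]) (h9 : s 9 = encodeEdges queries)
    (h10 : s 10 = encodeEdge e)
    (hP : bitLength ((picks ++ [Sum.inl (S₀.1 queries f)]).flatMap encodePick) ≤ N)
    (hQ : bitLength (encodeEdges (queries ++ [f])) ≤ N) :
    ∃ s', Runs O answerPart s (50000 * N) s' ∧
      s' 5 = (picks ++ [Sum.inl (S₀.1 queries f)]).flatMap encodePick ∧
      s' 9 = encodeEdges (queries ++ [f]) ∧
      s' 10 = encodeEdge (Sum.elim (fun _ => e) id (D picks (Sum.inl (S₀.1 queries f)))) ∧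
      (∀ r, r ∉ [5, 6, 7, 8, 9, 10] → s' r = s r) ∧ Bdd N s' := by
  have hE₀ : ∀ f : G₀.edgeSet, bitLength (encodeEdge f) ≤ N := fun f =>
    (bitLength_encodeEdge_le_encodePick_inl (G₁ := G₁) f).trans (hA _)
  set g := S₀.1 queries f with hg
  have r1 := runs_block (O := O) (cs := [.append 6 9]) (by simp [Instr.Plain]) (by simp) hN hs
  obtain ⟨s₁, hs₁⟩ : ∃ s₁, s₁ = runBlock O [.append 6 9] s := ⟨_, rfl⟩
  rw [← hs₁] at r1
  have f1 : ∀ r, r ∉ [9] → s₁ r = s r := fun r hr => by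
    rw [hs₁]
    exact runBlock_apply_of_notMem (by simpa [Instr.writes] using hr)
  have h9₁ : s₁ 9 = encodeEdges (queries ++ [f]) := by
    simp [hs₁, runBlock, Instr.run, h6, h9, encodeEdges_append, encodeEdges_singleton]
  have b1 : Bdd N s₁ := hs.of_frame _ f1 (by simpa [h9₁] using hQ)
  have ha : O 1 (s₁ 9) = encodeEdge g := by rw [h9₁, hO.2]
  have r2 := runs_ask (O := O) (k := 1) (src := 9) (dst := 6) (by omega) b1 (by rw [ha]; exact hE₀ g)
  rw [ha] at r2
  obtain ⟨s₂, hs₂⟩ : ∃ s₂, s₂ = Function.update s₁ 6 (encodeEdge g) := ⟨_, rfl⟩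
  rw [← hs₂] at r2
  have f2 : ∀ r, r ∉ [6] → s₂ r = s₁ r := fun r hr => by
    rw [hs₂, Function.update_of_ne (by simpa using hr)]
  have h6₂ : s₂ 6 = encodeEdge g := by simp [hs₂]
  have b2 : Bdd N s₂ := b1.of_frame _ f2 (by simpa [h6₂] using hE₀ g)
  have r3 := runs_block (O := O) (cs := [.append 8 5, .append 6 5]) (by simp [Instr.Plain])
    (by simp) hN b2
  obtain ⟨s₃, hs₃⟩ : ∃ s₃, s₃ = runBlock O [.append 8 5, .append 6 5] s₂ := ⟨_, rfl⟩
  rw [← hs₃] at r3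
  have f3 : ∀ r, r ∉ [5] → s₃ r = s₂ r := fun r hr => by
    rw [hs₃]
    exact runBlock_apply_of_notMem (by simpa [Instr.writes] using hr)
  -- Register 8 still holds `[0]` from the caller's test, which is the tag needed for a pick in the
  -- first graph.
  have h5₃ : s₃ 5 = (picks ++ [Sum.inl g]).flatMap encodePick := by
    simp [hs₃, runBlock, Instr.run, h6₂, f2, f1, h5, h8, encodePick]
  have b3 : Bdd N s₃ := b2.of_frame _ f3 (by simpa only [List.forall_mem_singleton, h5₃] using hP)
  have ha' : O 0 (s₃ 5) = encodePick (D picks (Sum.inl g)) := by rw [h5₃, hO.1]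
  have r4 := runs_ask (O := O) (k := 0) (src := 5) (dst := 6) (by omega) b3 (by rw [ha']; exact hA _)
  rw [ha'] at r4
  obtain ⟨s₄, hs₄⟩ : ∃ s₄, s₄ = Function.update s₃ 6 (encodePick (D picks (Sum.inl g))) := ⟨_, rfl⟩
  rw [← hs₄] at r4
  have f4 : ∀ r, r ∉ [6] → s₄ r = s₃ r := fun r hr => by
    rw [hs₄, Function.update_of_ne (by simpa using hr)]
  have h6₄ : s₄ 6 = encodePick (D picks (Sum.inl g)) := by simp [hs₄]
  have b4 : Bdd N s₄ := b3.of_frame _ f4 (by simpa [h6₄] using hA _)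
  have r5 := runs_block (O := O) (cs := [.load 7 [], .shift 6 7, .load 8 [1]])
    (by simp [Instr.Plain, bitLength]) (by simp) hN b4
  obtain ⟨s₅, hs₅⟩ : ∃ s₅, s₅ = runBlock O [.load 7 [], .shift 6 7, .load 8 [1]] s₄ := ⟨_, rfl⟩
  rw [← hs₅] at r5
  have f5 : ∀ r, r ∉ [6, 7, 8] → s₅ r = s₄ r := fun r hr => by
    rw [hs₅]
    refine runBlock_apply_of_notMem ?_
    simp only [List.mem_cons, List.not_mem_nil, or_false, not_or] at hr
    simp [Instr.writes, hr]
  have h6₅ : s₅ 6 = (encodePick (D picks (Sum.inl g))).tail := by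
    simp [hs₅, runBlock, Instr.run, Function.update_apply, h6₄]
  have h7₅ : s₅ 7 = (encodePick (D picks (Sum.inl g))).take 1 := by
    simp [hs₅, runBlock, Instr.run, Function.update_apply, h6₄]
  have h8₅ : s₅ 8 = [1] := by
    simp [hs₅, runBlock, Instr.run, Function.update_apply]
  have hAD := hA (D picks (Sum.inl g))
  have b5 : Bdd N s₅ := b4.of_frame _ f5 (by
    simp only [List.forall_mem_cons, h6₅, h7₅, h8₅]
    exact ⟨(bitLength_tail_le _).trans hAD, (bitLength_take_one_le _).trans hAD,
      by simpa [bitLength] using hN, by simp⟩)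
  have f15 : ∀ r, r ∉ [5, 6, 7, 8, 9] → s₅ r = s r := fun r hr => by
    simp only [List.mem_cons, List.not_mem_nil, or_false, not_or] at hr
    rw [f5 r (by simp [hr]), f4 r (by simp [hr]), f3 r (by simp [hr]), f2 r (by simp [hr]),
      f1 r (by simp [hr])]
  have h5₅ : s₅ 5 = (picks ++ [Sum.inl g]).flatMap encodePick := by
    rw [f5 5 (by simp), f4 5 (by simp), h5₃]
  have h9₅ : s₅ 9 = encodeEdges (queries ++ [f]) := by
    rw [f5 9 (by simp), f4 9 (by simp), f3 9 (by simp), f2 9 (by simp), h9₁]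
  cases hD : D picks (Sum.inl g) with
  | inl f' =>
    rw [hD] at h7₅
    have r6 := runs_block (O := O) (cs := []) (by simp) (by simp) hN b5
    refine ⟨s₅, (r1.seq (r2.seq (r3.seq (r4.seq (r5.seq (Runs.ite_false b5 ?_ r6)))))).mono
      (by omega), h5₅, h9₅, ?_, ?_, b5⟩
    · simp [Test.Holds, h7₅, h8₅, encodePick]
    · rw [f15 10 (by simp), h10, Sum.elim_inl]
    · intro r hr
      simp only [List.mem_cons, List.not_mem_nil, or_false, not_or] at hr
      exact f15 r (by simp [hr])
  | inr h =>
    rw [hD] at h7₅ h6₅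
    have r6 := runs_block (O := O) (cs := [.copy 6 10]) (by simp [Instr.Plain]) (by simp) hN b5
    refine ⟨_, (r1.seq (r2.seq (r3.seq (r4.seq (r5.seq (Runs.ite_true b5 ?_ r6)))))).mono
      (by omega), ?_, ?_, ?_, ?_, ?_⟩
    · simp [Test.Holds, h7₅, h8₅, encodePick]
    · simpa [runBlock, Instr.run] using h5₅
    · simpa [runBlock, Instr.run] using h9₅
    · simp [runBlock, Instr.run, h6₅, encodePick]
    · intro r hr
      simp only [List.mem_cons, List.not_mem_nil, or_false, not_or] at hr
      simp [runBlock, Instr.run, hr, f15]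
    · refine b5.of_frame [10]
        (fun r hr => runBlock_apply_of_notMem (by simpa [Instr.writes] using hr)) ?_
      simpa [runBlock, Instr.run] using b5 6

theorem queryPart_spec (hO : OraclesFor D S₀ O) {N : ℕ} (hN : 2 ≤ N)
    (hA : ∀ u : G₀.edgeSet ⊕ G₁.edgeSet, bitLength (encodePick u) ≤ N)
    {sim : Sim G₀.edgeSet G₁.edgeSet} {e : G₁.edgeSet} {w : List ℕ} {s : Store} (hs : Bdd N s)
    (h2 : s 2 = encodeEdge e ++ w) (h4 : s 4 = encodeEdges sim.used)
    (h5 : s 5 = sim.picks.flatMap encodePick) (h9 : s 9 = encodeEdges sim.queries)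
    (hU : bitLength (encodeEdges (sim.used ++ [e])) ≤ N)
    (hP : bitLength ((sim.nextPicks D S₀.1 e).flatMap encodePick) ≤ N)
    (hQ : bitLength (encodeEdges (sim.nextQueries D e)) ≤ N) :
    ∃ s', Runs O queryPart s (80000 * N) s' ∧ s' 2 = w ∧ s' 4 = encodeEdges (sim.used ++ [e]) ∧
      s' 5 = (sim.nextPicks D S₀.1 e).flatMap encodePick ∧
      s' 9 = encodeEdges (sim.nextQueries D e) ∧ s' 10 = encodeEdge (sim.candidate D S₀.1 e) ∧
      (∀ r, r ∉ [2, 3, 4, 5, 6, 7, 8, 9, 10] → s' r = s r) ∧ Bdd N s' := by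
  have hE₁ : ∀ f : G₁.edgeSet, bitLength (encodeEdge f) ≤ N := fun f =>
    (bitLength_encodeEdge_le_encodePick_inr (G₀ := G₀) f).trans (hA _)
  -- Register 5 only grows during a round, so the bound on its final contents covers the
  -- intermediate ones.
  have hP' : bitLength ((sim.picks ++ [Sum.inr e]).flatMap encodePick) ≤ N := by
    refine le_trans ?_ hP
    simp only [Sim.nextPicks]
    split
    · simp only [List.flatMap_append, bitLength_append]; omega
    · exact le_rfl
  have r1 := runs_block (O := O) (cs := [.load 3 [], .shift 2 3, .shift 2 3, .append 3 4,
    .load 8 [1], .append 8 5, .append 3 5]) (by simp [Instr.Plain, bitLength]) (by simp) hN hs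
  obtain ⟨s₁, hs₁⟩ : ∃ s₁, s₁ = runBlock O [.load 3 [], .shift 2 3, .shift 2 3, .append 3 4,
    .load 8 [1], .append 8 5, .append 3 5] s := ⟨_, rfl⟩
  rw [← hs₁] at r1
  have f1 : ∀ r, r ∉ [2, 3, 4, 5, 8] → s₁ r = s r := fun r hr => by
    rw [hs₁]
    refine runBlock_apply_of_notMem ?_
    simp only [List.mem_cons, List.not_mem_nil, or_false, not_or] at hr
    simp [Instr.writes, hr]
  have h2₁ : s₁ 2 = w := by
    simp [hs₁, runBlock, Instr.run, Function.update_apply, h2, encodeEdge]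
  have h3₁ : s₁ 3 = encodeEdge e := by
    simp [hs₁, runBlock, Instr.run, Function.update_apply, h2, encodeEdge]
  have h4₁ : s₁ 4 = encodeEdges (sim.used ++ [e]) := by
    rw [encodeEdges_append, encodeEdges_singleton]
    simp [hs₁, runBlock, Instr.run, Function.update_apply, h2, h4, encodeEdge]
  have h5₁ : s₁ 5 = (sim.picks ++ [Sum.inr e]).flatMap encodePick := by
    simp [hs₁, runBlock, Instr.run, Function.update_apply, h2, h5, encodePick, encodeEdge]
  have h8₁ : s₁ 8 = [1] := by
    simp [hs₁, runBlock, Instr.run, Function.update_apply]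
  have hx2 := hs 2
  rw [h2, bitLength_append] at hx2
  have b1 : Bdd N s₁ := hs.of_frame _ f1 (by
    simp only [List.forall_mem_cons, h2₁, h3₁, h4₁, h5₁, h8₁]
    exact ⟨by omega, hE₁ e, hU, hP', by simpa [bitLength] using hN, by simp⟩)
  have ha : O 0 (s₁ 5) = encodePick (D sim.picks (Sum.inr e)) := by rw [h5₁, hO.1]
  have r2 := runs_ask (O := O) (k := 0) (src := 5) (dst := 6) (by omega) b1 (by rw [ha]; exact hA _)
  rw [ha] at r2
  obtain ⟨s₂, hs₂⟩ : ∃ s₂, s₂ = Function.update s₁ 6 (encodePick (D sim.picks (Sum.inr e))) :=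
    ⟨_, rfl⟩
  rw [← hs₂] at r2
  have f2 : ∀ r, r ∉ [6] → s₂ r = s₁ r := fun r hr => by
    rw [hs₂, Function.update_of_ne (by simpa using hr)]
  have h6₂ : s₂ 6 = encodePick (D sim.picks (Sum.inr e)) := by simp [hs₂]
  have b2 : Bdd N s₂ := b1.of_frame _ f2 (by simpa [h6₂] using hA _)
  have r3 := runs_block (O := O) (cs := [.load 7 [], .shift 6 7, .copy 3 10, .load 8 [0]])
    (by simp [Instr.Plain, bitLength]) (by simp) hN b2
  obtain ⟨s₃, hs₃⟩ : ∃ s₃, s₃ = runBlock O [.load 7 [], .shift 6 7, .copy 3 10, .load 8 [0]] s₂ :=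
    ⟨_, rfl⟩
  rw [← hs₃] at r3
  have f3 : ∀ r, r ∉ [6, 7, 8, 10] → s₃ r = s₂ r := fun r hr => by
    rw [hs₃]
    refine runBlock_apply_of_notMem ?_
    simp only [List.mem_cons, List.not_mem_nil, or_false, not_or] at hr
    simp [Instr.writes, hr]
  have h6₃ : s₃ 6 = (encodePick (D sim.picks (Sum.inr e))).tail := by
    simp [hs₃, runBlock, Instr.run, Function.update_apply, h6₂]
  have h7₃ : s₃ 7 = (encodePick (D sim.picks (Sum.inr e))).take 1 := by
    simp [hs₃, runBlock, Instr.run, Function.update_apply, h6₂]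
  have h8₃ : s₃ 8 = [0] := by
    simp [hs₃, runBlock, Instr.run, Function.update_apply]
  have h10₃ : s₃ 10 = encodeEdge e := by
    simp [hs₃, runBlock, Instr.run, Function.update_apply, f2, h3₁]
  have hAD := hA (D sim.picks (Sum.inr e))
  have b3 : Bdd N s₃ := b2.of_frame _ f3 (by
    simp only [List.forall_mem_cons, h6₃, h7₃, h8₃, h10₃]
    exact ⟨(bitLength_tail_le _).trans hAD, (bitLength_take_one_le _).trans hAD,
      by simp [bitLength]; omega, hE₁ e, by simp⟩)
  have f13 : ∀ r, r ∉ [2, 3, 4, 5, 6, 7, 8, 9, 10] → s₃ r = s r := fun r hr => by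
    simp only [List.mem_cons, List.not_mem_nil, or_false, not_or] at hr
    rw [f3 r (by simp [hr]), f2 r (by simp [hr]), f1 r (by simp [hr])]
  have h2₃ : s₃ 2 = w := by rw [f3 2 (by simp), f2 2 (by simp), h2₁]
  have h4₃ : s₃ 4 = encodeEdges (sim.used ++ [e]) := by rw [f3 4 (by simp), f2 4 (by simp), h4₁]
  have h5₃ : s₃ 5 = (sim.picks ++ [Sum.inr e]).flatMap encodePick := by
    rw [f3 5 (by simp), f2 5 (by simp), h5₁]
  have h9₃ : s₃ 9 = encodeEdges sim.queries := by
    rw [f3 9 (by simp), f2 9 (by simp), f1 9 (by simp), h9]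
  cases hD : D sim.picks (Sum.inr e) with
  | inl f =>
    simp only [Sim.nextPicks, Sim.nextQueries, Sim.candidate, hD] at hP hQ ⊢
    rw [hD] at h6₃ h7₃
    obtain ⟨s₄, r4, h5₄, h9₄, h10₄, f4, b4⟩ := answerPart_spec hO hN hA b3 h5₃
      (by rw [h6₃, encodePick, List.tail_cons]) h8₃ h9₃ h10₃ hP hQ
    refine ⟨s₄, (r1.seq (r2.seq (r3.seq (Runs.ite_true b3 ?_ r4)))).mono (by omega),
      by rw [f4 2 (by simp), h2₃], by rw [f4 4 (by simp), h4₃], h5₄, h9₄, h10₄, ?_, b4⟩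
    · simp [Test.Holds, h7₃, h8₃, encodePick]
    · intro r hr
      have hr' := hr
      simp only [List.mem_cons, List.not_mem_nil, or_false, not_or] at hr'
      rw [f4 r (by simp [hr']), f13 r hr]
  | inr f =>
    simp only [Sim.nextPicks, Sim.nextQueries, Sim.candidate, hD] at hP hQ ⊢
    rw [hD] at h7₃
    have r4 := runs_block (O := O) (cs := []) (by simp) (by simp) hN b3
    refine ⟨s₃, (r1.seq (r2.seq (r3.seq (Runs.ite_false b3 ?_ r4)))).mono (by omega),
      h2₃, h4₃, h5₃, h9₃, h10₃, f13, b3⟩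
    simp [Test.Holds, h7₃, h8₃, encodePick]

/-- One round of the simulation. -/
def roundPart : Prog :=
  .seq queryPart (.seq (block [.copy 10 11, .append 1 11]) (.seq select (block [.append 10 4])))

theorem roundPart_spec (hO : OraclesFor D S₀ O) {N : ℕ} (hN : 2 ≤ N)
    (hA : ∀ u : G₀.edgeSet ⊕ G₁.edgeSet, bitLength (encodePick u) ≤ N) {all : List G₁.edgeSet}
    (hL : ∀ c, bitLength (encodeEdges (c :: all)) ≤ N)
    {sim : Sim G₀.edgeSet G₁.edgeSet} {e : G₁.edgeSet} {w : List ℕ} {s : Store} (hs : Bdd N s)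
    (h1 : s 1 = encodeEdges all)
    (h2 : s 2 = encodeEdge e ++ w) (h4 : s 4 = encodeEdges sim.used)
    (h5 : s 5 = sim.picks.flatMap encodePick) (h9 : s 9 = encodeEdges sim.queries)
    (hU : bitLength (encodeEdges (sim.next D S₀.1 all e).used) ≤ N)
    (hP : bitLength ((sim.next D S₀.1 all e).picks.flatMap encodePick) ≤ N)
    (hQ : bitLength (encodeEdges (sim.next D S₀.1 all e).queries) ≤ N) :
    ∃ s', Runs O roundPart s
        (100000 * N + (all.length + 2) * ((sim.used.length + 3) * (20030 * N))) s' ∧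
      s' 1 = encodeEdges all ∧ s' 2 = w ∧ s' 4 = encodeEdges (sim.next D S₀.1 all e).used ∧
      s' 5 = (sim.next D S₀.1 all e).picks.flatMap encodePick ∧
      s' 9 = encodeEdges (sim.next D S₀.1 all e).queries ∧
      s' 10 = encodeEdge (sim.reply D S₀.1 all e) ∧ Bdd N s' := by
  simp only [Sim.next] at hU hP hQ ⊢
  have hU' := hU
  rw [encodeEdges_append, bitLength_append] at hU'
  obtain ⟨s₁, r1, h2₁, h4₁, h5₁, h9₁, h10₁, f1, b1⟩ := queryPart_spec hO hN hA hs h2 h4 h5 h9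
    (by omega) hP hQ
  set c := sim.candidate D S₀.1 e with hc
  have r2 := runs_block (O := O) (cs := [.copy 10 11, .append 1 11]) (by simp [Instr.Plain])
    (by simp) hN b1
  obtain ⟨s₂, hs₂⟩ : ∃ s₂, s₂ = runBlock O [.copy 10 11, .append 1 11] s₁ := ⟨_, rfl⟩
  rw [← hs₂] at r2
  have f2 : ∀ r, r ∉ [11] → s₂ r = s₁ r := fun r hr => by
    rw [hs₂]
    exact runBlock_apply_of_notMem (by simpa [Instr.writes] using hr)
  have h11₂ : s₂ 11 = encodeEdges (c :: all) := by
    simp [hs₂, runBlock, Instr.run, h10₁, f1, h1, encodeEdges_cons]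
  have b2 : Bdd N s₂ := b1.of_frame _ f2 (by simpa [h11₂] using hL c)
  obtain ⟨s₃, r3, h10₃, f3, b3⟩ := select_spec (O := O) hN (c :: all) b2
    (by rw [f2 10 (by simp), h10₁]) h11₂ (by rw [f2 4 (by simp), h4₁])
  have r4 := runs_block (O := O) (cs := [.append 10 4]) (by simp [Instr.Plain]) (by simp) hN b3
  obtain ⟨s₄, hs₄⟩ : ∃ s₄, s₄ = runBlock O [.append 10 4] s₃ := ⟨_, rfl⟩
  rw [← hs₄] at r4
  have f4 : ∀ r, r ∉ [4] → s₄ r = s₃ r := fun r hr => by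
    rw [hs₄]
    exact runBlock_apply_of_notMem (by simpa [Instr.writes] using hr)
  have h4₄ : s₄ 4 = encodeEdges (sim.used ++ [e] ++ [sim.reply D S₀.1 all e]) := by
    rw [encodeEdges_append _ [sim.reply D S₀.1 all e], encodeEdges_singleton]
    simp [hs₄, runBlock, Instr.run, h10₃, f3, f2, h4₁, Sim.reply, ← hc]
  have b4 : Bdd N s₄ := b3.of_frame _ f4
    (by simpa only [List.forall_mem_singleton, h4₄] using hU)
  refine ⟨s₄, (r1.seq (r2.seq (r3.seq r4))).mono ?_, ?_, ?_, h4₄, ?_, ?_, ?_, b4⟩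
  · simp only [List.length_cons, List.length_append, List.length_nil]
    ring_nf
    omega
  · rw [f4 1 (by simp), f3 1 (by simp), f2 1 (by simp), f1 1 (by simp), h1]
  · rw [f4 2 (by simp), f3 2 (by simp), f2 2 (by simp), h2₁]
  · rw [f4 5 (by simp), f3 5 (by simp), f2 5 (by simp), h5₁]
  · rw [f4 9 (by simp), f3 9 (by simp), f2 9 (by simp), h9₁]
  · rw [f4 10 (by simp), h10₃, Sim.reply]

end Simulate

/-! ### The whole algorithm and its running time -/

section Algorithm

variable {O : Oracles} {n₀ n₁ : ℕ} {G₀ : SimpleGraph (Fin n₀)} {G₁ : SimpleGraph (Fin n₁)}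
  {D : Responder (G₀.edgeSet ⊕ G₁.edgeSet)} {S₀ : SecondStrategy G₀}

/-- Handle all moves in register 2. -/
def simLoop : Prog := .untilDo (.empty 2) roundPart

/-- The algorithm: remove the number of vertices from the encoding of the second graph, handle all
moves, and output the last reply. -/
def simProg : Prog := .seq (block [.shift 1 0]) (.seq simLoop (block [.copy 10 0]))

/-- Here `p` are the moves already handled and `rest` those still in register 2. The cap `k` on
their total number makes the cost of a round uniform. The condition on register 10 is vacuous before
the first move. -/
theorem simLoop_spec (hO : OraclesFor D S₀ O) {N k : ℕ} (hN : 2 ≤ N)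
    (hA : ∀ u : G₀.edgeSet ⊕ G₁.edgeSet, bitLength (encodePick u) ≤ N) {all : List G₁.edgeSet}
    (hL : ∀ c, bitLength (encodeEdges (c :: all)) ≤ N)
    (hU : ∀ p : List G₁.edgeSet, p.length ≤ k →
      bitLength (encodeEdges (Sim.after D S₀.1 all p).used) ≤ N)
    (hP : ∀ p : List G₁.edgeSet, p.length ≤ k →
      bitLength ((Sim.after D S₀.1 all p).picks.flatMap encodePick) ≤ N)
    (hQ : ∀ p : List G₁.edgeSet, p.length ≤ k →
      bitLength (encodeEdges (Sim.after D S₀.1 all p).queries) ≤ N)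
    (rest p : List G₁.edgeSet) (hk : p.length + rest.length ≤ k) {s : Store} (hs : Bdd N s)
    (h1 : s 1 = encodeEdges all) (h2 : s 2 = encodeEdges rest)
    (h4 : s 4 = encodeEdges (Sim.after D S₀.1 all p).used)
    (h5 : s 5 = (Sim.after D S₀.1 all p).picks.flatMap encodePick)
    (h9 : s 9 = encodeEdges (Sim.after D S₀.1 all p).queries)
    (h10 : ∀ l a, p = l ++ [a] → s 10 = encodeEdge (simStrategy D S₀.1 all l a)) :
    ∃ s', Runs O simLoop s ((rest.length + 1) *
        (100003 * N + (all.length + 2) * ((2 * k + 3) * (20030 * N)))) s' ∧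
      (∀ l a, p ++ rest = l ++ [a] → s' 10 = encodeEdge (simStrategy D S₀.1 all l a)) ∧
      Bdd N s' := by
  induction rest generalizing p s with
  | nil =>
    refine ⟨s, (Runs.until_done (b := .empty 2) hs h2).mono ?_, by simpa using h10, hs⟩
    rw [List.length_nil, Nat.zero_add, Nat.one_mul]
    omega
  | cons e rest ih =>
    rw [List.length_cons] at hk
    have hk' : (p ++ [e]).length ≤ k := by simp; omega
    obtain ⟨s₁, r₁, g1, g2, g4, g5, g9, g10, b₁⟩ := roundPart_spec hO hN hA hL hs h1 h2 h4 h5 h9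
      (Sim.after_append D S₀.1 all p e ▸ hU _ hk') (Sim.after_append D S₀.1 all p e ▸ hP _ hk')
      (Sim.after_append D S₀.1 all p e ▸ hQ _ hk')
    rw [← Sim.after_append] at g4 g5 g9
    obtain ⟨s₂, r₂, g10₂, b₂⟩ := ih (p ++ [e]) (by simp; omega) b₁ g1 g2 g4 g5 g9 (by
      intro l a hla
      obtain ⟨rfl, h⟩ := List.append_inj' hla rfl
      obtain rfl : e = a := by simpa using h
      exact g10)
    refine ⟨s₂, (Runs.until_step hs ?_ r₁ r₂).mono ?_, by simpa using g10₂, b₂⟩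
    · simp [Test.Holds, h2, encodeEdges_cons, encodeEdge]
    · rw [List.length_cons, Nat.succ_mul (rest.length + 1), Sim.length_used_after]
      have : (all.length + 2) * ((2 * p.length + 3) * (20030 * N)) ≤
          (all.length + 2) * ((2 * k + 3) * (20030 * N)) := by
        gcongr
        omega
      omega

/-- The algorithm computes the strategy obtained by the simulation in polynomial time. -/
theorem outputs_simProg (hO : OraclesFor D S₀ O) {all : List G₁.edgeSet}
    (hall : encodeGraph G₁ = n₁ :: encodeEdges all) (l : List G₁.edgeSet) (a : G₁.edgeSet) :
    Outputs simProg O (encodeGraph G₀) (encodeGraph G₁) (encodeEdges (l ++ [a]))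
      (encodeEdge (simStrategy D S₀.1 all l a))
      (2000000 * (bitLength (encodeGraph G₀) + bitLength (encodeGraph G₁) +
        bitLength (encodeEdges (l ++ [a])) + 1) ^ 5) := by
  set n := bitLength (encodeGraph G₀) + bitLength (encodeGraph G₁) +
    bitLength (encodeEdges (l ++ [a])) with hn
  obtain ⟨all₀, -, hall₀⟩ := exists_encodeGraph_eq G₀
  have hs₀ : n₀.size + 1 + bitLength (encodeEdges all₀) = bitLength (encodeGraph G₀) := by
    rw [hall₀, bitLength_cons]
  have hs₁ : n₁.size + 1 + bitLength (encodeEdges all) = bitLength (encodeGraph G₁) := by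
    rw [hall, bitLength_cons]
  have hk := length_le_bitLength_encodeEdges (l ++ [a])
  have hall_len := length_le_bitLength_encodeEdges all
  set k := (l ++ [a]).length with hk_def
  -- A register lists at most `2 * k ≤ 2 * n` moves of bit length at most `2 * n + 2`; the factor 7
  -- leaves room for this and for the linear bounds on the other words.
  obtain ⟨N, hNdef⟩ : ∃ N, N = 7 * (n + 1) ^ 2 := ⟨_, rfl⟩
  have hNn : 7 * (n + 1) ≤ N := by nlinarith
  have hE₀ : ∀ e : G₀.edgeSet, bitLength (encodeEdge e) ≤ 2 * n := fun e =>
    (bitLength_encodeEdge_le e).trans (by omega)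
  have hE₁ : ∀ e : G₁.edgeSet, bitLength (encodeEdge e) ≤ 2 * n := fun e =>
    (bitLength_encodeEdge_le e).trans (by omega)
  have hpick : ∀ u : G₀.edgeSet ⊕ G₁.edgeSet, bitLength (encodePick u) ≤ 2 * n + 2 := by
    rintro (e | e)
    · have := hE₀ e
      simp only [encodePick, bitLength_cons, Nat.size_zero]
      omega
    · have := hE₁ e
      simp only [encodePick, bitLength_cons, Nat.size_one]
      omega
  have hmul : ∀ x ≤ 2 * k, x * (2 * n + 2) ≤ N := by
    intro x hx
    have : x ≤ 2 * n := by omega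
    calc x * (2 * n + 2) ≤ 2 * n * (2 * n + 2) := by gcongr
      _ ≤ N := by nlinarith
  have b₀ : Bdd N (initStore (encodeGraph G₀) (encodeGraph G₁) (encodeEdges (l ++ [a]))) := by
    intro r
    rcases r with _ | _ | _ | r <;> simp only [initStore, bitLength_nil] <;> omega
  -- The number `n₁` is discarded at the end of register 0, which is overwritten by the output.
  have r₁ := runs_block (O := O) (cs := [.shift 1 0]) (by simp [Instr.Plain]) (by simp) (by omega) b₀
  obtain ⟨s₁, hs₁'⟩ : ∃ s₁, s₁ = runBlock O [.shift 1 0]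
    (initStore (encodeGraph G₀) (encodeGraph G₁) (encodeEdges (l ++ [a]))) := ⟨_, rfl⟩
  rw [← hs₁'] at r₁
  have f1 : ∀ r, r ∉ [1, 0] → s₁ r =
      initStore (encodeGraph G₀) (encodeGraph G₁) (encodeEdges (l ++ [a])) r := fun r hr => by
    rw [hs₁']
    exact runBlock_apply_of_notMem (by simpa [Instr.writes] using hr)
  have h0₁ : s₁ 0 = encodeGraph G₀ ++ [n₁] := by
    simp [hs₁', runBlock, Instr.run, initStore, hall]
  have h1₁ : s₁ 1 = encodeEdges all := by
    simp [hs₁', runBlock, Instr.run, initStore, hall]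
  have b₁ : Bdd N s₁ := b₀.of_frame _ f1 (by
    simp only [List.forall_mem_cons, h0₁, h1₁, bitLength_append, bitLength_cons, bitLength_nil]
    exact ⟨by omega, by omega, by simp⟩)
  obtain ⟨s₂, r₂, h10, b₂⟩ := simLoop_spec (k := k) hO (by omega : 2 ≤ N)
    (fun u => (hpick u).trans (by omega)) (all := all)
    (fun c => by
      rw [encodeEdges_cons, bitLength_append]
      have := hE₁ c
      omega)
    (fun p hp => by
      refine (bitLength_flatMap_le (q := 2 * n + 2) (fun e => (hE₁ e).trans (by omega)) _).trans
        (hmul _ ?_)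
      rw [Sim.length_used_after]
      omega)
    (fun p hp => by
      refine (bitLength_flatMap_le hpick _).trans (hmul _ ?_)
      exact (Sim.length_picks_after_le D S₀.1 all p).trans (by omega))
    (fun p hp => by
      refine (bitLength_flatMap_le (q := 2 * n + 2) (fun e => (hE₀ e).trans (by omega)) _).trans
        (hmul _ ?_)
      exact (Sim.length_queries_after_le D S₀.1 all p).trans (by omega))
    (l ++ [a]) [] (by simp [hk_def]) b₁ h1₁ (by rw [f1 2 (by simp)]; rfl)
    (by rw [f1 4 (by simp)]; rfl) (by rw [f1 5 (by simp)]; rfl) (by rw [f1 9 (by simp)]; rfl)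
    (by simp)
  have r₃ := runs_block (O := O) (cs := [.copy 10 0]) (by simp [Instr.Plain]) (by simp) (by omega) b₂
  obtain ⟨t, ht, hexec⟩ := r₁.seq (r₂.seq r₃)
  refine ⟨t, _, hexec, ht.trans ?_, ?_⟩
  · rw [← hk_def, hNdef]
    -- The degree is five: the number of moves, the length of the edge list and the number of
    -- colored edges are each linear in `n`, and `N` is quadratic. The two outer blocks add at most
    -- `140000 * (n + 1) ^ 2`, which fits under the constant 2000000.
    have h1 : (k + 1) * (100003 * (7 * (n + 1) ^ 2) +
        (all.length + 2) * ((2 * k + 3) * (20030 * (7 * (n + 1) ^ 2)))) ≤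
        (n + 1) * (100003 * (7 * (n + 1) ^ 2) * (n + 1) ^ 2 +
        (2 * (n + 1)) * ((3 * (n + 1)) * (20030 * (7 * (n + 1) ^ 2)))) := by
      have : 1 ≤ (n + 1) ^ 2 := Nat.one_le_pow _ _ (by omega)
      exact Nat.mul_le_mul (by omega) (Nat.add_le_add (Nat.le_mul_of_pos_right _ this)
        (Nat.mul_le_mul (by omega) (Nat.mul_le_mul (by omega) le_rfl)))
    have h2 : (n + 1) ^ 2 ≤ (n + 1) ^ 5 := Nat.pow_le_pow_right (by omega) (by norm_num)
    have h3 : (n + 1) * (100003 * (7 * (n + 1) ^ 2) * (n + 1) ^ 2 +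
        (2 * (n + 1)) * ((3 * (n + 1)) * (20030 * (7 * (n + 1) ^ 2)))) =
        1541281 * (n + 1) ^ 5 := by ring
    omega
  · simpa [runBlock, Instr.run] using h10 l a rfl

end Algorithm

end SymGame

theorem mainTheorem2 :
    (∀ (V₀ V₁ : Type*) [Finite V₀] [Finite V₁] (G₀ : SimpleGraph V₀) (G₁ : SimpleGraph V₁),
      G₁.CliqueFree 3 →
      min (ENat.map (fun l : ℕ => l / 2) (SymGame.efLength G₀.lineGraph G₁.lineGraph) : ℕ∞)
        (SymGame.symLength G₀ : ℕ∞) ≤ (SymGame.symLength G₁ : ℕ∞)) ∧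
    (∃ (P : SymGame.Prog) (p : Polynomial ℕ),
      ∀ (n₀ n₁ : ℕ) (G₀ : SimpleGraph (Fin n₀)) (G₁ : SimpleGraph (Fin n₁)), G₁.CliqueFree 3 →
      ∀ (D : SymGame.Responder (G₀.edgeSet ⊕ G₁.edgeSet)) (S₀ : SymGame.SecondStrategy G₀),
      ∃ S : SymGame.SecondStrategy G₁,
        (∀ O : SymGame.Oracles, SymGame.OraclesFor D S₀ O →
          ∀ (l : List G₁.edgeSet) (a : G₁.edgeSet), (l ++ [a]).Nodup →
          2 * (l.length + 1) ≤ Nat.card G₁.edgeSet →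
          SymGame.Outputs P O (SymGame.encodeGraph G₀) (SymGame.encodeGraph G₁)
            (SymGame.encodeEdges (l ++ [a])) (SymGame.encodeEdge (S.1 l a))
            (p.eval (SymGame.bitLength (SymGame.encodeGraph G₀) +
              SymGame.bitLength (SymGame.encodeGraph G₁) +
              SymGame.bitLength (SymGame.encodeEdges (l ++ [a]))))) ∧
        ∀ l m : ℕ, (l : ℕ∞) ≤ SymGame.efGuarantee G₀.lineGraph G₁.lineGraph D →
          m ≤ SymGame.symGuarantee S₀ → min (l / 2) m ≤ SymGame.symGuarantee S) := by
  refine ⟨fun _ _ _ _ _ _ h => SymGame.min_efLength_symLength_le h, SymGame.simProg,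
    Polynomial.C 2000000 * (Polynomial.X + 1) ^ 5, fun n₀ n₁ G₀ G₁ hG₁ D S₀ => ?_⟩
  obtain ⟨all, hmem, hall⟩ := SymGame.exists_encodeGraph_eq G₁
  refine ⟨SymGame.simSecond D S₀ all hmem, fun O hO l a _ _ => ?_, fun l m hD hS₀ =>
    SymGame.le_symGuarantee_simSecond hG₁ hmem hD hS₀⟩
  rw [Polynomial.eval_mul, Polynomial.eval_C, Polynomial.eval_pow, Polynomial.eval_add,
    Polynomial.eval_X, Polynomial.eval_one]
  exact SymGame.outputs_simProg hO hall l a
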